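/- Let $K$ be a number field with algebraic closure $\overline K$. For $p=(A,B,C,D,E)$ let $X_p\subset\mathbb P^3$ be the quartic surface $F_p=0$, where $$F_p=A(x^4+y^4+z^4+w^4)+Bxyzw+C(x^2y^2+z^2w^2)+D(x^2z^2+y^2w^2)+E(x^2w^2+y^2z^2),$$ let $\Delta(p)=16A^3+AB^2-4A(C^2+D^2+E^2)+4CDE$, and let $S_3=\{\Delta=0\}\subset\mathbb P^4$ be the Segre cubic. Its ten nodes are $$q_1,\dots,q_{10}=(1,0,-2,-2,2),\ (1,0,-2,2,-2),\ (1,0,2,-2,-2),\ (1,0,2,2,2),\ (0,\mp2,1,0,0),\ (0,\mp2,0,1,0),\ (0,\mp2,0,0,1)$$ (in each of the last three pairs the upper sign comes first), and $F_{q_i}=Q_i^2$ for the quadratic forms $Q_1,\dots,Q_{10}$ given by $x^2-y^2-z^2+w^2$, $x^2-y^2+z^2-w^2$, $x^2+y^2-z^2-w^2$, $x^2+y^2+z^2+w^2$, $xy\mp zw$, $xz\mp yw$, $xw\mp yz$. Fix $i\in\{1,\dots,10\}$ and $p\in K^5$ such that $X_p$ is smooth and $\Delta=\Delta(p)\neq0$.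 Assume that the line joining $p$ and $q_i$ meets $S_3$ in a third point $p_i\neq q_i$, and let $(A_i,B_i,C_i,D_i,E_i)\in K^5$ be the homogeneous coordinates of $p_i$ scaled such that $\beta F_p=\Delta\,Q_i^2+F_{p_i}$ for some $\beta\in K$. Assume $B_i\ne0$. The conics associated to $q_i$ are constructed as follows. Write $F_p=\alpha Q_i^2+\alpha'F_{p_i}$. For a singular point $s=[s_0:s_1:s_2:s_3]$ of $X_{p_i}$ let $T=s_0x+s_1y+s_2z+s_3w$ and write $F_{p_i}=\mu Q'^2+\lambda T$ with a quadratic form $Q'$ and a cubic form $\lambda$. The associated conics are $\{T=\sqrt{\alpha}\,Q_i+\sqrt{-\alpha'\mu}\,Q'=0\}$, for all singular points $s$ and all choices of the square roots (everything over $\overline K$). Put $$a=-A_i^2B_i^2,\quad b=4(2A_iD_i-C_iE_i)(2A_iE_i-C_iD_i),\quad c=2\big(A_i^2B_i^2-2(E_i^2+D_i^2)(4A_i^2+C_i^2)+16A_iC_iD_iE_i\big),$$ $$d=4A_i^2-C_i^2,\qquad e=E_i^2-D_i^2,$$ and let $r_{1,i},r_{2,i},r_{\mu,i},\overline{r_{\mu,i}}\in\overline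 K$ be such that - $r_{1,i}$ is a root of $ax^8+bx^6+cx^4+bx^2+a$, with $E_ir_{1,i}^2\neq D_i$; - $r_{2,i}$ is a root of $d(E_ir_{1,i}^2-D_i)x^2+A_i\big(d(r_{1,i}^4-1)+e(r_{1,i}^4+1)\big)+C_ie\,r_{1,i}^2$; - $r_{\mu,i}$ is a root of $x^2+\frac1\Delta(A_ir_{1,i}^4+C_ir_{1,i}^2+A_i)$; - $\overline{r_{\mu,i}}$ is a root of $x^2+\frac1\Delta(A_i\overline r_{1,i}^4+C_i\overline r_{1,i}^2+A_i)$, where $\overline r_{1,i}=r_{2,i}/r_{3,i}$ and $r_{3,i}$ is determined by $2(C_i^2-4A_i^2)r_{3,i}r_{2,i}r_{1,i}+B_iC_ir_{1,i}^2+A_iB_i+A_iB_ir_{1,i}^4=0$. Then there are exactly $32$ conics (possibly degenerate) associated to $q_i$. They lie on $X_p$, and each of them is defined over $$K_i=K(r_{1,i},r_{2,i},r_{\mu,i},\overline{r_{\mu,i}}),$$ that is, it is the zero set of a nonzero linear form and a quadratic form, not divisible by the linear form, with coefficients in $K_i$. If $X_p$ contains no line, then all $32$ conics are smooth. -/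

import Mathlib

open MvPolynomial LinearAlgebra.Projectivization

namespace HeisenbergQuartic

section Equations

variable {R : Type*} [CommRing R]

/-- The equation of `X_p`, for `p = [A, B, C, D, E]`. The variables `X 0, X 1, X 2, X 3` are
`x, y, z, w`. -/
noncomputable def quartic (p : Fin 5 → R) : MvPolynomial (Fin 4) R :=
  C (p 0) * (X 0 ^ 4 + X 1 ^ 4 + X 2 ^ 4 + X 3 ^ 4) + C (p 1) * (X 0 * X 1 * X 2 * X 3)
    + C (p 2) * (X 0 ^ 2 * X 1 ^ 2 + X 2 ^ 2 * X 3 ^ 2)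
    + C (p 3) * (X 0 ^ 2 * X 2 ^ 2 + X 1 ^ 2 * X 3 ^ 2)
    + C (p 4) * (X 0 ^ 2 * X 3 ^ 2 + X 1 ^ 2 * X 2 ^ 2)

/-- The value at `p` of the cubic form `Δ` that defines the Segre cubic `S₃`. -/
def segre (p : Fin 5 → R) : R :=
  16 * p 0 ^ 3 + p 0 * p 1 ^ 2 - 4 * p 0 * (p 2 ^ 2 + p 3 ^ 2 + p 4 ^ 2) + 4 * p 2 * p 3 * p 4

variable (R) in
/-- The ten nodes `q_i` of the Segre cubic. -/
def node : Fin 10 → Fin 5 → R :=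
  ![![1, 0, -2, -2, 2], ![1, 0, -2, 2, -2], ![1, 0, 2, -2, -2], ![1, 0, 2, 2, 2],
    ![0, -2, 1, 0, 0], ![0, 2, 1, 0, 0], ![0, -2, 0, 1, 0], ![0, 2, 0, 1, 0],
    ![0, -2, 0, 0, 1], ![0, 2, 0, 0, 1]]

variable (R) in
/-- The equations of the ten quadrics `Q_i`. -/
noncomputable def nodeQuadric : Fin 10 → MvPolynomial (Fin 4) R :=
  ![X 0 ^ 2 - X 1 ^ 2 - X 2 ^ 2 + X 3 ^ 2, X 0 ^ 2 - X 1 ^ 2 + X 2 ^ 2 - X 3 ^ 2,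
    X 0 ^ 2 + X 1 ^ 2 - X 2 ^ 2 - X 3 ^ 2, X 0 ^ 2 + X 1 ^ 2 + X 2 ^ 2 + X 3 ^ 2,
    X 0 * X 1 - X 2 * X 3, X 0 * X 1 + X 2 * X 3,
    X 0 * X 2 - X 1 * X 3, X 0 * X 2 + X 1 * X 3,
    X 0 * X 3 - X 1 * X 2, X 0 * X 3 + X 1 * X 2]

/-- The quartic attached to the node `q_i` is the quadric `Q_i` with multiplicity two. -/
theorem quartic_node (i : Fin 10) : quartic (node R i) = nodeQuadric R i ^ 2 := by
  fin_cases i <;> simp [quartic, node, nodeQuadric, map_ofNat] <;> ring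

/-- The linear form `s₀ x + s₁ y + s₂ z + s₃ w`. -/
noncomputable def linearForm (s : Fin 4 → R) : MvPolynomial (Fin 4) R := ∑ j, C (s j) * X j

/-- `a x⁸ + b x⁶ + c x⁴ + b x² + a`, with `a, b, c` built from `v = [A_i, B_i, C_i, D_i, E_i]`. -/
noncomputable def firstPoly (v : Fin 5 → R) : Polynomial R :=
  let a := -(v 0 ^ 2 * v 1 ^ 2)
  let b := 4 * (2 * v 0 * v 3 - v 2 * v 4) * (2 * v 0 * v 4 - v 2 * v 3)
  let c := 2 * (v 0 ^ 2 * v 1 ^ 2 - 2 * (v 4 ^ 2 + v 3 ^ 2) * (4 * v 0 ^ 2 + v 2 ^ 2)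
    + 16 * v 0 * v 2 * v 3 * v 4)
  .C a * .X ^ 8 + .C b * .X ^ 6 + .C c * .X ^ 4 + .C b * .X ^ 2 + .C a

/-- `d (E r² - D) x² + A (d (r⁴ - 1) + e (r⁴ + 1)) + C e r²`, where `d = 4 A² - C²` and
`e = E² - D²`, for `v = [A, B, C, D, E]`. -/
noncomputable def secondPoly (v : Fin 5 → R) (r : R) : Polynomial R :=
  let d := 4 * v 0 ^ 2 - v 2 ^ 2
  let e := v 4 ^ 2 - v 3 ^ 2
  .C (d * (v 4 * r ^ 2 - v 3)) * .X ^ 2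
    + .C (v 0 * (d * (r ^ 4 - 1) + e * (r ^ 4 + 1)) + v 2 * e * r ^ 2)

end Equations

section Geometry

variable {k : Type*} [Field k]

/-- `x² + (1/Δ) (A r⁴ + C r² + A)`, for `v = [A, B, C, D, E]`. -/
noncomputable def muPoly (Δ : k) (v : Fin 5 → k) (r : k) : Polynomial k :=
  .X ^ 2 + .C (1 / Δ * (v 0 * r ^ 4 + v 2 * r ^ 2 + v 0))

/-- `v` represents the third point of intersection, other than the double point `q_i`, of the
Segre cubic with the line joining `q_i` and `p`. -/
structure IsThirdPoint (i : Fin 10) (p v : Fin 5 → k) : Prop where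
  mem_line : v ∈ Submodule.span k {node k i, p}
  ne_node : v ∉ Submodule.span k {node k i}
  mem_segre : segre v = 0

/-- The projective zero set in `ℙ³(k)` of a set of forms. -/
def zeroLocus (S : Set (MvPolynomial (Fin 4) k)) : Set (ℙ k (Fin 4 → k)) :=
  {x | ∀ f ∈ S, ∀ u ∈ x.submodule, eval u f = 0}

/-- `x` is a singular point of the surface `f = 0` in `ℙ³(k)`. -/
def IsSingularPoint (f : MvPolynomial (Fin 4) k) (x : ℙ k (Fin 4 → k)) : Prop :=
  x ∈ zeroLocus {f} ∧ ∀ j, x ∈ zeroLocus {pderiv j f}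

/-- The surface `f = 0` contains a line of `ℙ³(k)`. -/
def ContainsLine (f : MvPolynomial (Fin 4) k) : Prop :=
  ∃ W : Submodule k (Fin 4 → k), Module.finrank k W = 2 ∧
    ∀ x : ℙ k (Fin 4 → k), x.submodule ≤ W → x ∈ zeroLocus {f}

/-- `Z` is one of the conics on `X_p` attached to the node `q_i`. Here `v` represents the third
point `p_i` on the line joining `q_i` and `p`. One writes
`F_p = α Q_i² + α' F_{p_i}`, takes the plane `T` dual to a singular point `s` of `X_{p_i}`, writes
`F_{p_i} = μ Q'² + l T`, and `Z` is the conic `T = √α Q_i + √(-α' μ) Q' = 0` for some choice of the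
two square roots. -/
def IsAssociatedConic (i : Fin 10) (p v : Fin 5 → k) (Z : Set (ℙ k (Fin 4 → k))) : Prop :=
  ∃ (s : Fin 4 → k) (hs : s ≠ 0), IsSingularPoint (quartic v) (.mk k s hs) ∧
    ∃ (α α' μ a b : k) (Q' l : MvPolynomial (Fin 4) k),
      Q'.IsHomogeneous 2 ∧ l.IsHomogeneous 3 ∧
      quartic p = C α * nodeQuadric k i ^ 2 + C α' * quartic v ∧
      quartic v = C μ * Q' ^ 2 + l * linearForm s ∧
      a ^ 2 = α ∧ b ^ 2 = -α' * μ ∧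
      Z = zeroLocus {linearForm s, C a * nodeQuadric k i + C b * Q'}

variable {K : Type*} [Field K] [Algebra K k]

/-- `Z` is the conic `h = g = 0`, where `h` is a nonzero linear form and `g` a quadratic form that
does not vanish on the plane `h = 0`, both with coefficients in `L`. -/
def IsConicEquations (L : IntermediateField K k) (Z : Set (ℙ k (Fin 4 → k)))
    (h g : MvPolynomial (Fin 4) L) : Prop :=
  h ≠ 0 ∧ h.IsHomogeneous 1 ∧ g.IsHomogeneous 2 ∧
    ¬ map (algebraMap L k) h ∣ map (algebraMap L k) g ∧
    Z = zeroLocus {map (algebraMap L k) h, map (algebraMap L k) g}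

/-- `Z` is a conic in `ℙ³(k)`, possibly degenerate, that is defined over `L`. -/
def IsConicOver (L : IntermediateField K k) (Z : Set (ℙ k (Fin 4 → k))) : Prop :=
  ∃ h g : MvPolynomial (Fin 4) L, IsConicEquations L Z h g

/-- `Z` is a smooth conic in `ℙ³(k)` that is defined over `L` (Jacobian criterion). -/
def IsSmoothConicOver (L : IntermediateField K k) (Z : Set (ℙ k (Fin 4 → k))) : Prop :=
  ∃ h g : MvPolynomial (Fin 4) L, IsConicEquations L Z h g ∧
    ∀ x ∈ Z, LinearIndependent k
      ![fun j => eval x.rep (pderiv j (map (algebraMap L k) h)),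
        fun j => eval x.rep (pderiv j (map (algebraMap L k) g))]

end Geometry

end HeisenbergQuartic

namespace HeisenbergQuartic

/-! Since the Segre cubic vanishes at `v`, the quartic `F_v` is a Kummer surface, and its singular
points and tropes can be written down. Smoothness of `X_p` keeps `p` off fifteen hyperplanes, for
each of which the quartic has an explicit singular point. Each of the fifteen planes in the Segre
cubic lies in three of these hyperplanes, and every node `q_i` lies in one of the three; hence `v`
lies on none of the planes (`thirdPoint_facet`). With `v 1 ≠ 0` this yields nonzero `γ, δ, ε` with
`γ² = (C - 2A) / (C + 2A)`, and likewise for `δ` with `D` and `ε` with `E` (`exists_isParam`). The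
point whose squared coordinates are the signed sums of `γδε, γ, δ, ε` is singular on `F_v`, and its
sixteen images under even sign changes and double transpositions are all the singular points
(`exists_translate_of_grad`).

Up to constants, `F_v` is the square of a diagonal quadric minus a product of four linear forms
(`quartic_eq`). So on the plane `T = 0` dual to a node `t` one has `F_v = μ D²`, where `D` is scaled
to be `1` at `(t₁, -t₀, 0, 0)` and `μ` is the value of `F_v` there (`quartic_decomp`). With `ρ² =
-α' μ / α`, the restriction of `F_p` to the plane is `α (Q_i + ρ D)(Q_i - ρ D)` (`quartic_factor`),
which gives two conics. Any other admissible `Q'` gives the same pair, because `T` is prime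
(`exists_conic_eq`).

The given polynomials say that `[r₁ : 1 : r₃ : r₂]` is a node (`exists_coordinates`) and that `rμ`
is a possible `ρ`. The value `μ` is the same at all sixteen nodes (`edge_translate`), and `D` is
rational in the node, so all the equations have coefficients in the stated field.

A conic lying in two planes would be a double line, and then the remaining partial derivative of
`F_p`, a cubic form on that line, would vanish at a singular point of `X_p`
(`false_of_double_line`). The two conics in one plane are told apart on a suitable line
(`exists_separating_line`). Finally, a singular conic contains a line of `X_p`. -/

variable {k : Type*} [Field k]

/-! ### Parametrised nodes and the Heisenberg action. -/

/-- `s` is a node of the Kummer quartic `F_v = 0`, normalised so that the squares of its coordinates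
are the signed sums of `γ δ ε, γ, δ, ε`. -/
structure IsParam (v : Fin 5 → k) (s : Fin 4 → k) (γ δ ε : k) : Prop where
  ne0 : v 0 ≠ 0
  ne1 : v 1 ≠ 0
  neγ : γ ≠ 0
  neδ : δ ≠ 0
  neε : ε ≠ 0
  hγ : 1 - γ ^ 2 ≠ 0
  hδ : 1 - δ ^ 2 ≠ 0
  hε : 1 - ε ^ 2 ≠ 0
  eq2 : v 2 * (1 - γ ^ 2) = 2 * v 0 * (1 + γ ^ 2)
  eq3 : v 3 * (1 - δ ^ 2) = 2 * v 0 * (1 + δ ^ 2)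
  eq4 : v 4 * (1 - ε ^ 2) = 2 * v 0 * (1 + ε ^ 2)
  sq0 : s 0 ^ 2 = γ * δ * ε + γ + δ + ε
  sq1 : s 1 ^ 2 = γ * δ * ε + γ - δ - ε
  sq2 : s 2 ^ 2 = γ * δ * ε - γ + δ - ε
  sq3 : s 3 ^ 2 = γ * δ * ε - γ - δ + ε
  prod : v 1 * ((1 - γ ^ 2) * (1 - δ ^ 2) * (1 - ε ^ 2)) = -8 * v 0 * (s 0 * s 1 * s 2 * s 3)

/-- Even sign changes. -/
def sgn : Fin 4 → Fin 4 → ℤ := ![![1, 1, 1, 1], ![1, 1, -1, -1], ![1, -1, 1, -1], ![1, -1, -1, 1]]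

/-- The Klein four-group of double transpositions. -/
def vier : Fin 4 → Fin 4 → Fin 4 := ![![0, 1, 2, 3], ![1, 0, 3, 2], ![2, 3, 0, 1], ![3, 2, 1, 0]]

/-- The Heisenberg translates of `s`. -/
def translate (a b : Fin 4) (s : Fin 4 → k) : Fin 4 → k := fun j => sgn a j * s (vier b j)

namespace IsParam

variable {v : Fin 5 → k} {s : Fin 4 → k} {γ δ ε : k}

lemma prod_ne [CharZero k] (h : IsParam v s γ δ ε) : s 0 * s 1 * s 2 * s 3 ≠ 0 := by
  intro h0
  have := h.prod
  rw [h0, mul_zero] at this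
  exact mul_ne_zero h.ne1 (mul_ne_zero (mul_ne_zero h.hγ h.hδ) h.hε) this

lemma ne_zero [CharZero k] (h : IsParam v s γ δ ε) (j : Fin 4) : s j ≠ 0 := by
  have := h.prod_ne
  simp only [mul_ne_zero_iff] at this
  fin_cases j <;> simp_all

/-- A double transposition of the coordinates amounts to changing the signs of two of `γ, δ, ε`; an
even sign change affects neither the squares nor the product. -/
lemma exists_translate (h : IsParam v s γ δ ε) (a b : Fin 4) :
    ∃ γ' δ' ε', IsParam v (translate a b s) γ' δ' ε' := by
  obtain ⟨h1, h2, h3, h4, h5, h6, h7, h8, h9, h10, h11, h12, h13, h14, h15, h16⟩ := h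
  have key : ∃ γ' δ' ε', IsParam v (translate 0 b s) γ' δ' ε' := by
    fin_cases b
    · refine ⟨γ, δ, ε, ?_⟩
      constructor <;> try simp [translate, sgn, vier]
      all_goals first | assumption | linear_combination h16
    · refine ⟨γ, -δ, -ε, ?_⟩
      constructor <;> try simp [translate, sgn, vier]
      all_goals
        first
        | assumption | linear_combination h16 | linear_combination h12
        | linear_combination h13 | linear_combination h14 | linear_combination h15
    · refine ⟨-γ, δ, -ε, ?_⟩
      constructor <;> try simp [translate, sgn, vier]
      all_goals
        first
        | assumption | linear_combination h16 | linear_combination h12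
        | linear_combination h13 | linear_combination h14 | linear_combination h15
    · refine ⟨-γ, -δ, ε, ?_⟩
      constructor <;> try simp [translate, sgn, vier]
      all_goals
        first
        | assumption | linear_combination h16 | linear_combination h12
        | linear_combination h13 | linear_combination h14 | linear_combination h15
  obtain ⟨γ', δ', ε', g1, g2, g3, g4, g5, g6, g7, g8, g9, g10, g11, g12, g13, g14, g15, g16⟩ := key
  simp only [translate] at g12 g13 g14 g15 g16
  refine ⟨γ', δ', ε', g1, g2, g3, g4, g5, g6, g7, g8, g9, g10, g11, ?_, ?_, ?_, ?_, ?_⟩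
  · rw [← g12]; fin_cases a <;> simp [translate, sgn]
  · rw [← g13]; fin_cases a <;> simp [translate, sgn]
  · rw [← g14]; fin_cases a <;> simp [translate, sgn]
  · rw [← g15]; fin_cases a <;> simp [translate, sgn]
  · rw [g16]; fin_cases a <;> simp [translate, sgn]

end IsParam

/-! ### The gradient of the quartic, and its tropes. -/

/-- The partial derivatives of `F_v` at `s`. -/
def grad (v : Fin 5 → k) (s : Fin 4 → k) : Fin 4 → k :=
  ![4 * v 0 * s 0 ^ 3 + v 1 * (s 1 * s 2 * s 3)
      + 2 * s 0 * (v 2 * s 1 ^ 2 + v 3 * s 2 ^ 2 + v 4 * s 3 ^ 2),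
    4 * v 0 * s 1 ^ 3 + v 1 * (s 0 * s 2 * s 3)
      + 2 * s 1 * (v 2 * s 0 ^ 2 + v 3 * s 3 ^ 2 + v 4 * s 2 ^ 2),
    4 * v 0 * s 2 ^ 3 + v 1 * (s 0 * s 1 * s 3)
      + 2 * s 2 * (v 2 * s 3 ^ 2 + v 3 * s 0 ^ 2 + v 4 * s 1 ^ 2),
    4 * v 0 * s 3 ^ 3 + v 1 * (s 0 * s 1 * s 2)
      + 2 * s 3 * (v 2 * s 2 ^ 2 + v 3 * s 1 ^ 2 + v 4 * s 0 ^ 2)]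

lemma eval_pderiv_quartic (v : Fin 5 → k) (s : Fin 4 → k) (j : Fin 4) :
    eval s (pderiv j (quartic v)) = grad v s j := by
  fin_cases j <;> simp [quartic, grad, pderiv_X] <;> ring

lemma eval_quartic (v : Fin 5 → k) (s : Fin 4 → k) :
    eval s (quartic v) = v 0 * (s 0 ^ 4 + s 1 ^ 4 + s 2 ^ 4 + s 3 ^ 4)
      + v 1 * (s 0 * s 1 * s 2 * s 3)
      + v 2 * (s 0 ^ 2 * s 1 ^ 2 + s 2 ^ 2 * s 3 ^ 2)
      + v 3 * (s 0 ^ 2 * s 2 ^ 2 + s 1 ^ 2 * s 3 ^ 2)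
      + v 4 * (s 0 ^ 2 * s 3 ^ 2 + s 1 ^ 2 * s 2 ^ 2) := by
  simp [quartic]

lemma eval_quartic_eq_sum_grad (v : Fin 5 → k) (s : Fin 4 → k) :
    4 * eval s (quartic v) = ∑ j, s j * grad v s j := by
  simp [eval_quartic, Fin.sum_univ_four, grad]; ring

lemma quartic_isHomogeneous (v : Fin 5 → k) : (quartic v).IsHomogeneous 4 := by
  have hX : ∀ j : Fin 4, (X j : MvPolynomial (Fin 4) k).IsHomogeneous 1 := isHomogeneous_X k
  have h2 : ∀ i j : Fin 4, (X i ^ 2 * X j ^ 2 : MvPolynomial (Fin 4) k).IsHomogeneous 4 :=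
    fun i j => ((hX i).pow 2).mul ((hX j).pow 2)
  have h4 : ∀ j : Fin 4, (X j ^ 4 : MvPolynomial (Fin 4) k).IsHomogeneous 4 :=
    fun j => (hX j).pow 4
  exact ((((((((h4 0).add (h4 1)).add (h4 2)).add (h4 3)).C_mul _).add
    (((((hX 0).mul (hX 1)).mul (hX 2)).mul (hX 3)).C_mul _)).add
    (((h2 0 1).add (h2 2 3)).C_mul _)).add (((h2 0 2).add (h2 1 3)).C_mul _)).add
    (((h2 0 3).add (h2 1 2)).C_mul _)

namespace IsParam

variable {v : Fin 5 → k} {s : Fin 4 → k} {γ δ ε : k}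

/-- After multiplication by `s 0` the derivative is a polynomial in the squares of the coordinates
and their product, all of which the parametrisation supplies. -/
lemma grad_zero [CharZero k] (h : IsParam v s γ δ ε) : grad v s 0 = 0 := by
  have hm := h.prod
  have hs := h.ne_zero 0
  have hP := mul_ne_zero (mul_ne_zero h.hγ h.hδ) h.hε
  refine (mul_eq_zero.1 ?_).resolve_left (mul_ne_zero hs hP)
  have e1 : (1 - γ ^ 2) * (1 - δ ^ 2) * (1 - ε ^ 2) *
      (2 * v 0 * s 0 ^ 2 + v 2 * s 1 ^ 2 + v 3 * s 2 ^ 2 + v 4 * s 3 ^ 2)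
      = 4 * v 0 * (s 1 ^ 2 * s 2 ^ 2 * s 3 ^ 2) := by
    rw [h.sq0, h.sq1, h.sq2, h.sq3]
    linear_combination (γ * δ * ε + γ - δ - ε) * (1 - δ ^ 2) * (1 - ε ^ 2) * h.eq2 +
      (γ * δ * ε - γ + δ - ε) * (1 - γ ^ 2) * (1 - ε ^ 2) * h.eq3 +
      (γ * δ * ε - γ - δ + ε) * (1 - γ ^ 2) * (1 - δ ^ 2) * h.eq4
  simp only [grad, Matrix.cons_val_zero]
  linear_combination 2 * s 0 ^ 2 * e1 + s 0 * s 1 * s 2 * s 3 * hm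

lemma grad_translate (v : Fin 5 → k) (s : Fin 4 → k) (b : Fin 4) :
    grad v (translate 0 b s) 0 = grad v s b := by
  fin_cases b <;> simp [grad, translate, sgn, vier] <;> left <;> ring

lemma grad_eq_zero [CharZero k] (h : IsParam v s γ δ ε) (j : Fin 4) : grad v s j = 0 := by
  obtain ⟨_, _, _, h'⟩ := h.exists_translate 0 j
  rw [← grad_translate, h'.grad_zero]

/-- The product of the four linear forms involves `s` only through the squares `s j ^ 2` and the
product of the coordinates. The identity exhibits the four planes as tropes: on each of them the
quartic is a multiple of a square. -/
lemma quartic_eq (h : IsParam v s γ δ ε) :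
    C ((1 - γ ^ 2) * (1 - δ ^ 2) * (1 - ε ^ 2)) * quartic v = C (v 0) *
      ((C (1 + δ * ε + γ * ε + γ * δ) * X 0 ^ 2 + C (1 + δ * ε - γ * ε - γ * δ) * X 1 ^ 2 +
        C (1 - δ * ε + γ * ε - γ * δ) * X 2 ^ 2 + C (1 - δ * ε - γ * ε + γ * δ) * X 3 ^ 2) ^ 2 -
      linearForm (translate 0 0 s) * linearForm (translate 1 0 s) *
        linearForm (translate 2 0 s) * linearForm (translate 3 0 s)) := by
  have hN : linearForm (translate 0 0 s) * linearForm (translate 1 0 s) *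
        linearForm (translate 2 0 s) * linearForm (translate 3 0 s) =
      C ((s 0 ^ 2) ^ 2) * X 0 ^ 4 + C ((s 1 ^ 2) ^ 2) * X 1 ^ 4 + C ((s 2 ^ 2) ^ 2) * X 2 ^ 4
      + C ((s 3 ^ 2) ^ 2) * X 3 ^ 4 - 2 * (C (s 0 ^ 2 * s 1 ^ 2) * (X 0 ^ 2 * X 1 ^ 2) +
      C (s 0 ^ 2 * s 2 ^ 2) * (X 0 ^ 2 * X 2 ^ 2) + C (s 0 ^ 2 * s 3 ^ 2) * (X 0 ^ 2 * X 3 ^ 2) +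
      C (s 1 ^ 2 * s 2 ^ 2) * (X 1 ^ 2 * X 2 ^ 2) + C (s 1 ^ 2 * s 3 ^ 2) * (X 1 ^ 2 * X 3 ^ 2) +
      C (s 2 ^ 2 * s 3 ^ 2) * (X 2 ^ 2 * X 3 ^ 2)) +
      8 * C (s 0 * s 1 * s 2 * s 3) * (X 0 * X 1 * X 2 * X 3) := by
    simp [linearForm, Fin.sum_univ_four, translate, sgn, vier]
    ring
  have e1 := congrArg (C (σ := Fin 4)) h.prod
  have e2 := congrArg (C (σ := Fin 4)) h.eq2
  have e3 := congrArg (C (σ := Fin 4)) h.eq3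
  have e4 := congrArg (C (σ := Fin 4)) h.eq4
  rw [hN, h.sq0, h.sq1, h.sq2, h.sq3]
  simp only [map_mul, map_add, map_sub, map_neg, map_pow, map_one, map_ofNat] at *
  simp only [quartic]
  linear_combination (X 0 * X 1 * X 2 * X 3) * e1 +
    (1 - C δ ^ 2) * (1 - C ε ^ 2) * (X 0 ^ 2 * X 1 ^ 2 + X 2 ^ 2 * X 3 ^ 2) * e2 +
    (1 - C γ ^ 2) * (1 - C ε ^ 2) * (X 0 ^ 2 * X 2 ^ 2 + X 1 ^ 2 * X 3 ^ 2) * e3 +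
    (1 - C γ ^ 2) * (1 - C δ ^ 2) * (X 0 ^ 2 * X 3 ^ 2 + X 1 ^ 2 * X 2 ^ 2) * e4

end IsParam

/-! ### Existence of a node, and classification of the singular points. -/

lemma exists_isParam [IsAlgClosed k] [CharZero k] {v : Fin 5 → k} (h0 : v 0 ≠ 0) (h1 : v 1 ≠ 0)
    (h2 : v 2 + 2 * v 0 ≠ 0) (h2' : v 2 - 2 * v 0 ≠ 0)
    (h3 : v 3 + 2 * v 0 ≠ 0) (h3' : v 3 - 2 * v 0 ≠ 0)
    (h4 : v 4 + 2 * v 0 ≠ 0) (h4' : v 4 - 2 * v 0 ≠ 0) (hS : segre v = 0) :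
    ∃ s γ δ ε, IsParam v s γ δ ε := by
  have root : ∀ c : k, c + 2 * v 0 ≠ 0 → c - 2 * v 0 ≠ 0 → ∃ z : k, z ≠ 0 ∧ 1 - z ^ 2 ≠ 0 ∧
      c * (1 - z ^ 2) = 2 * v 0 * (1 + z ^ 2) := by
    intro c hc hc'
    obtain ⟨z, hz⟩ := IsAlgClosed.exists_pow_nat_eq ((c - 2 * v 0) / (c + 2 * v 0)) two_pos
    rw [eq_div_iff hc] at hz
    have e : c * (1 - z ^ 2) = 2 * v 0 * (1 + z ^ 2) := by linear_combination -hz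
    refine ⟨z, ?_, ?_, e⟩
    · rintro rfl
      exact hc' (by linear_combination -hz)
    · intro h
      have : 4 * v 0 = 0 := by linear_combination -e + (c + 2 * v 0) * h
      simp [h0] at this
  obtain ⟨γ, g0, g1, g2⟩ := root _ h2 h2'
  obtain ⟨δ, d0, d1, d2⟩ := root _ h3 h3'
  obtain ⟨ε, e0, e1, e2⟩ := root _ h4 h4'
  obtain ⟨s0, hs0⟩ := IsAlgClosed.exists_pow_nat_eq (γ * δ * ε + γ + δ + ε) two_pos
  obtain ⟨s1, hs1⟩ := IsAlgClosed.exists_pow_nat_eq (γ * δ * ε + γ - δ - ε) two_pos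
  obtain ⟨s2, hs2⟩ := IsAlgClosed.exists_pow_nat_eq (γ * δ * ε - γ + δ - ε) two_pos
  obtain ⟨s3, hs3⟩ := IsAlgClosed.exists_pow_nat_eq (γ * δ * ε - γ - δ + ε) two_pos
  -- In terms of `γ, δ, ε` the Segre equation becomes the square of the normalisation of the
  -- product.
  have hsq : (v 1 * ((1 - γ ^ 2) * (1 - δ ^ 2) * (1 - ε ^ 2))) ^ 2 =
      (-8 * v 0 * (s0 * s1 * s2 * s3)) ^ 2 := by
    have : (-8 * v 0 * (s0 * s1 * s2 * s3)) ^ 2 =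
        64 * v 0 ^ 2 * (s0 ^ 2 * s1 ^ 2 * s2 ^ 2 * s3 ^ 2) := by ring
    rw [this, hs0, hs1, hs2, hs3]
    refine mul_left_cancel₀ h0 ?_
    rw [← eq_div_iff g1] at g2
    rw [← eq_div_iff d1] at d2
    rw [← eq_div_iff e1] at e2
    rw [segre, g2, d2, e2] at hS
    field_simp at hS
    linear_combination hS
  rcases sq_eq_sq_iff_eq_or_eq_neg.1 hsq with h | h
  · exact ⟨![s0, s1, s2, s3], γ, δ, ε, h0, h1, g0, d0, e0, g1, d1, e1, g2, d2, e2, hs0, hs1, hs2,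
      hs3, h⟩
  -- Reversing one square root corrects the sign of the product.
  · refine ⟨![-s0, s1, s2, s3], γ, δ, ε, h0, h1, g0, d0, e0, g1, d1, e1, g2, d2, e2, ?_, hs1, hs2,
      hs3, ?_⟩
    · simpa using hs0
    · rw [h]; simp

/-- As soon as one coordinate vanishes, the products of any two of the other three vanish, so two
more coordinates are zero. -/
lemma cremona {w0 w1 w2 w3 c d e : k} (hc : c ≠ 0) (hd : d ≠ 0) (he : e ≠ 0)
    (h1 : w0 * w1 = c * (w2 * w3)) (h2 : w0 * w2 = d * (w1 * w3)) (h3 : w0 * w3 = e * (w1 * w2)) :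
    (w0 ≠ 0 ∧ w1 ≠ 0 ∧ w2 ≠ 0 ∧ w3 ≠ 0) ∨ (w1 = 0 ∧ w2 = 0 ∧ w3 = 0) ∨
    (w0 = 0 ∧ w2 = 0 ∧ w3 = 0) ∨ (w0 = 0 ∧ w1 = 0 ∧ w3 = 0) ∨ (w0 = 0 ∧ w1 = 0 ∧ w2 = 0) := by
  by_cases a0 : w0 = 0 <;> by_cases a1 : w1 = 0 <;> by_cases a2 : w2 = 0 <;>
    by_cases a3 : w3 = 0 <;> simp_all

namespace IsParam

variable {v : Fin 5 → k} {s : Fin 4 → k} {γ δ ε : k}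

lemma sq_prod (h : IsParam v s γ δ ε) :
    v 1 ^ 2 * ((1 - γ ^ 2) * (1 - δ ^ 2) * (1 - ε ^ 2)) ^ 2 =
    64 * v 0 ^ 2 * ((γ * δ * ε + γ + δ + ε) * (γ * δ * ε + γ - δ - ε) * (γ * δ * ε - γ + δ - ε) *
      (γ * δ * ε - γ - δ + ε)) := by
  rw [← h.sq0, ← h.sq1, ← h.sq2, ← h.sq3]
  linear_combination (v 1 * ((1 - γ ^ 2) * (1 - δ ^ 2) * (1 - ε ^ 2)) +
    -8 * v 0 * (s 0 * s 1 * s 2 * s 3)) * h.prod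

/-- A singular point of `F_v = 0` whose coordinates have equal squares up to an even sign change,
 does not exist. -/
lemma not_unit [CharZero k] (h : IsParam v s γ δ ε) {t : Fin 4 → k} (ht : t ≠ 0)
    (hg : grad v t 0 = 0) (x y z : k) (hx : x ^ 2 = 1) (hy : y ^ 2 = 1) (hz : x * y = z)
    (h1 : t 1 ^ 2 = x * t 0 ^ 2) (h2 : t 2 ^ 2 = y * t 0 ^ 2) (h3 : t 3 ^ 2 = z * t 0 ^ 2) :
    False := by
  subst hz
  have t0 : t 0 ≠ 0 := by
    intro h0
    rw [h0] at h1 h2 h3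
    apply ht
    ext j
    fin_cases j <;> simp_all
  simp only [grad, Matrix.cons_val_zero] at hg
  have e : (4 * v 0 + 2 * (x * v 2 + y * v 3 + x * y * v 4)) * t 0 ^ 3 =
      -v 1 * (t 1 * t 2 * t 3) := by
    linear_combination hg - 2 * t 0 * (v 2 * h1 + v 3 * h2 + v 4 * h3)
  have e2 : (4 * v 0 + 2 * (x * v 2 + y * v 3 + x * y * v 4)) ^ 2 = v 1 ^ 2 := by
    refine mul_right_cancel₀ (pow_ne_zero 6 t0) ?_
    have : (t 1 * t 2 * t 3) ^ 2 = t 0 ^ 6 := by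
      rw [mul_pow, mul_pow, h1, h2, h3]
      linear_combination (y ^ 2 * t 0 ^ 6) * hx + t 0 ^ 6 * hy
    linear_combination v 1 ^ 2 * this + e *
      ((4 * v 0 + 2 * (x * v 2 + y * v 3 + x * y * v 4)) * t 0 ^ 3 - v 1 * (t 1 * t 2 * t 3))
  have hB := h.sq_prod
  have hL : (1 - γ ^ 2) * (1 - δ ^ 2) * (1 - ε ^ 2) *
      (4 * v 0 + 2 * (x * v 2 + y * v 3 + x * y * v 4)) = 4 * v 0 *
      ((1 - γ ^ 2) * (1 - δ ^ 2) * (1 - ε ^ 2) + x * (1 + γ ^ 2) * (1 - δ ^ 2) * (1 - ε ^ 2) +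
      y * (1 + δ ^ 2) * (1 - γ ^ 2) * (1 - ε ^ 2) +
      x * y * (1 + ε ^ 2) * (1 - γ ^ 2) * (1 - δ ^ 2)) := by
    linear_combination 2 * x * (1 - δ ^ 2) * (1 - ε ^ 2) * h.eq2 +
      2 * y * (1 - γ ^ 2) * (1 - ε ^ 2) * h.eq3 + 2 * x * y * (1 - γ ^ 2) * (1 - δ ^ 2) * h.eq4
  rw [← e2, ← mul_pow, mul_comm, hL] at hB
  have hP : 256 * v 0 ^ 2 * ((1 - γ ^ 2) * (1 - δ ^ 2) * (1 - ε ^ 2)) ≠ 0 := by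
    simp [h.hγ, h.hδ, h.hε, h.ne0]
  have n1 := pow_ne_zero 2 h.neγ
  have n2 := pow_ne_zero 2 h.neδ
  have n3 := pow_ne_zero 2 h.neε
  -- For each choice of signs, the two sides of `hB` differ by the nonzero constant of `hP`, times a
  -- product of two of `γ², δ², ε²` unless both signs are positive.
  rcases sq_eq_one_iff.1 hx with rfl | rfl <;>
  rcases sq_eq_one_iff.1 hy with rfl | rfl
  · exact hP (by linear_combination hB)
  · exact mul_ne_zero hP (mul_ne_zero n2 n3) (by linear_combination hB)
  · exact mul_ne_zero hP (mul_ne_zero n1 n3) (by linear_combination hB)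
  · exact mul_ne_zero hP (mul_ne_zero n1 n2) (by linear_combination hB)

end IsParam

lemma forall_fin_four {P : Fin 4 → Prop} : (∀ j, P j) ↔ P 0 ∧ P 1 ∧ P 2 ∧ P 3 := by
  simp [Fin.forall_fin_succ]

namespace IsParam

variable {v : Fin 5 → k} {s : Fin 4 → k} {γ δ ε : k}

/-- Signed sums of the `t j * grad v t j` with two minus signs lose the monomial `xyzw`. In the
Hadamard transform `w` of the squared coordinates they become the equations of `cremona`. The
solutions with three zeros are excluded by `not_unit`; the others are the transforms of the permuted
node. -/
lemma exists_vier_of_grad [CharZero k] (h : IsParam v s γ δ ε) {t : Fin 4 → k} (ht : t ≠ 0)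
    (hg : ∀ j, grad v t j = 0) :
    ∃ b, ∃ c : k, c ≠ 0 ∧ ∀ j, t j ^ 2 = c * s (vier b j) ^ 2 := by
  have g0 := hg 0
  have g1 := hg 1
  have g2 := hg 2
  have g3 := hg 3
  simp only [grad, Matrix.cons_val] at g0 g1 g2 g3
  obtain ⟨w0, hw0⟩ : ∃ w, w = t 0 ^ 2 + t 1 ^ 2 + t 2 ^ 2 + t 3 ^ 2 := ⟨_, rfl⟩
  obtain ⟨w1, hw1⟩ : ∃ w, w = t 0 ^ 2 + t 1 ^ 2 - t 2 ^ 2 - t 3 ^ 2 := ⟨_, rfl⟩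
  obtain ⟨w2, hw2⟩ : ∃ w, w = t 0 ^ 2 - t 1 ^ 2 + t 2 ^ 2 - t 3 ^ 2 := ⟨_, rfl⟩
  obtain ⟨w3, hw3⟩ : ∃ w, w = t 0 ^ 2 - t 1 ^ 2 - t 2 ^ 2 + t 3 ^ 2 := ⟨_, rfl⟩
  have two : (2 : k) ≠ 0 := two_ne_zero
  have c1 : w0 * w1 = γ ^ 2 * (w2 * w3) := by
    refine mul_left_cancel₀ (mul_ne_zero two h.ne0) ?_
    rw [hw0, hw1, hw2, hw3]
    linear_combination (1 - γ ^ 2) / 2 * (t 0 * g0 + t 1 * g1 - t 2 * g2 - t 3 * g3) -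
      2 * (t 0 ^ 2 * t 1 ^ 2 - t 2 ^ 2 * t 3 ^ 2) * h.eq2
  have c2 : w0 * w2 = δ ^ 2 * (w1 * w3) := by
    refine mul_left_cancel₀ (mul_ne_zero two h.ne0) ?_
    rw [hw0, hw1, hw2, hw3]
    linear_combination (1 - δ ^ 2) / 2 * (t 0 * g0 - t 1 * g1 + t 2 * g2 - t 3 * g3) -
      2 * (t 0 ^ 2 * t 2 ^ 2 - t 1 ^ 2 * t 3 ^ 2) * h.eq3
  have c3 : w0 * w3 = ε ^ 2 * (w1 * w2) := by
    refine mul_left_cancel₀ (mul_ne_zero two h.ne0) ?_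
    rw [hw0, hw1, hw2, hw3]
    linear_combination (1 - ε ^ 2) / 2 * (t 0 * g0 - t 1 * g1 - t 2 * g2 + t 3 * g3) -
      2 * (t 0 ^ 2 * t 3 ^ 2 - t 1 ^ 2 * t 2 ^ 2) * h.eq4
  have n1 := h.neγ
  have n2 := h.neδ
  have n3 := h.neε
  rcases cremona (pow_ne_zero 2 n1) (pow_ne_zero 2 n2) (pow_ne_zero 2 n3) c1 c2 c3 with
    ⟨a0, a1, a2, a3⟩ | ⟨a1, a2, a3⟩ | ⟨a1, a2, a3⟩ | ⟨a1, a2, a3⟩ | ⟨a1, a2, a3⟩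
  · obtain ⟨τ, hτ⟩ : ∃ τ, τ * (γ * δ * ε) = w0 := ⟨w0 / (γ * δ * ε), by field_simp⟩
    have hτ0 : τ ≠ 0 := by
      rintro rfl
      simp [← hτ] at a0
    have q1 : w1 ^ 2 = (τ * γ) ^ 2 := by
      refine mul_left_cancel₀ (mul_ne_zero (mul_ne_zero a2 a3)
        (mul_ne_zero (pow_ne_zero 2 n2) (pow_ne_zero 2 n3))) ?_
      linear_combination -w0 * w3 * c2 - δ ^ 2 * w1 * w3 * c3
        - (w2 * w3) * (τ * (γ * δ * ε) + w0) * hτ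
    have q2 : w2 ^ 2 = (τ * δ) ^ 2 := by
      refine mul_left_cancel₀ (mul_ne_zero (mul_ne_zero a1 a3)
        (mul_ne_zero (pow_ne_zero 2 n1) (pow_ne_zero 2 n3))) ?_
      linear_combination -w0 * w3 * c1 - γ ^ 2 * w2 * w3 * c3
        - (w1 * w3) * (τ * (γ * δ * ε) + w0) * hτ
    have q3 : w3 ^ 2 = (τ * ε) ^ 2 := by
      refine mul_left_cancel₀ (mul_ne_zero (mul_ne_zero a1 a2)
        (mul_ne_zero (pow_ne_zero 2 n1) (pow_ne_zero 2 n2))) ?_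
      linear_combination -w0 * w2 * c1 - γ ^ 2 * w2 * w3 * c2
        - (w1 * w2) * (τ * (γ * δ * ε) + w0) * hτ
    have hc : τ / 4 ≠ 0 := div_ne_zero hτ0 (by norm_num)
    have bad : 2 * (τ ^ 2 * γ ^ 2 * δ * ε) ≠ 0 := by simp [hτ0, n1, n2, n3]
    rw [← hτ] at c1
    have fin : ∀ b, w0 + w1 + w2 + w3 = τ * s (vier b 0) ^ 2 →
        w0 + w1 - w2 - w3 = τ * s (vier b 1) ^ 2 →
        w0 - w1 + w2 - w3 = τ * s (vier b 2) ^ 2 →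
        w0 - w1 - w2 + w3 = τ * s (vier b 3) ^ 2 →
        ∃ b, ∃ c : k, c ≠ 0 ∧ ∀ j, t j ^ 2 = c * s (vier b j) ^ 2 := by
      intro b e0 e1 e2 e3
      refine ⟨b, τ / 4, hc, forall_fin_four.2 ⟨?_, ?_, ?_, ?_⟩⟩
      · linear_combination (e0 - hw0 - hw1 - hw2 - hw3) / 4
      · linear_combination (e1 - hw0 - hw1 + hw2 + hw3) / 4
      · linear_combination (e2 - hw0 + hw1 - hw2 + hw3) / 4
      · linear_combination (e3 - hw0 + hw1 + hw2 - hw3) / 4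
    -- The equation `c1` admits only an even number of minus signs, and each such choice is one of
    -- the four double transpositions.
    rcases sq_eq_sq_iff_eq_or_eq_neg.1 q1 with r1 | r1 <;>
    rcases sq_eq_sq_iff_eq_or_eq_neg.1 q2 with r2 | r2 <;>
    rcases sq_eq_sq_iff_eq_or_eq_neg.1 q3 with r3 | r3 <;> rw [r1, r2, r3] at c1 fin
    · apply fin 0 <;> simp [vier, ← hτ, h.sq0, h.sq1, h.sq2, h.sq3] <;> ring
    · exact absurd (by linear_combination c1) bad
    · exact absurd (by linear_combination c1) bad
    · apply fin 1 <;> simp [vier, ← hτ, h.sq0, h.sq1, h.sq2, h.sq3] <;> ring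
    · exact absurd (by linear_combination -c1) bad
    · apply fin 2 <;> simp [vier, ← hτ, h.sq0, h.sq1, h.sq2, h.sq3] <;> ring
    · apply fin 3 <;> simp [vier, ← hτ, h.sq0, h.sq1, h.sq2, h.sq3] <;> ring
    · exact absurd (by linear_combination -c1) bad
  · rw [hw1] at a1
    rw [hw2] at a2
    rw [hw3] at a3
    exact (h.not_unit ht g0 1 1 1 (by ring) (by ring) (by ring)
      (by linear_combination -(a2 + a3) / 2) (by linear_combination -(a1 + a3) / 2)
      (by linear_combination -(a1 + a2) / 2)).elim
  · rw [hw0] at a1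
    rw [hw2] at a2
    rw [hw3] at a3
    exact (h.not_unit ht g0 1 (-1) (-1) (by ring) (by ring) (by ring)
      (by linear_combination -(a2 + a3) / 2) (by linear_combination (a1 + a2) / 2)
      (by linear_combination (a1 + a3) / 2)).elim
  · rw [hw0] at a1
    rw [hw1] at a2
    rw [hw3] at a3
    exact (h.not_unit ht g0 (-1) 1 (-1) (by ring) (by ring) (by ring)
      (by linear_combination (a1 + a2) / 2) (by linear_combination -(a2 + a3) / 2)
      (by linear_combination (a1 + a3) / 2)).elim
  · rw [hw0] at a1
    rw [hw1] at a2
    rw [hw2] at a3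
    exact (h.not_unit ht g0 (-1) (-1) 1 (by ring) (by ring) (by ring)
      (by linear_combination (a1 + a2) / 2) (by linear_combination (a1 + a3) / 2)
      (by linear_combination -(a2 + a3) / 2)).elim

/-- The singular points of `F_v = 0` are the Heisenberg translates of a single one. -/
theorem exists_translate_of_grad [CharZero k] (h : IsParam v s γ δ ε) {t : Fin 4 → k} (ht : t ≠ 0)
    (hg : ∀ j, grad v t j = 0) :
    ∃ a b, ∃ c : k, c ≠ 0 ∧ t = c • translate a b s := by
  obtain ⟨b, τ, hτ, hsq⟩ := h.exists_vier_of_grad ht hg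
  obtain ⟨_, _, _, h'⟩ := h.exists_translate 0 b
  have e : ∀ j, s (vier b j) = translate 0 b s j := by
    intro j
    fin_cases j <;> simp [translate, sgn]
  have tr : ∀ a, translate a b s = translate a 0 (translate 0 b s) := by
    intro a
    ext j
    rw [translate, translate, ← e]
    fin_cases j <;> rfl
  suffices ∃ a, ∃ c : k, c ≠ 0 ∧ t = c • translate a 0 (translate 0 b s) by
    obtain ⟨a, c, hc, ht⟩ := this
    exact ⟨a, b, c, hc, by rw [ht, ← tr]⟩
  simp only [e] at hsq
  generalize translate 0 b s = u at *
  have hu := h'.ne_zero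
  obtain ⟨c, hc⟩ : ∃ c, t 0 = c * u 0 := ⟨t 0 / u 0, by field_simp [hu 0]⟩
  have hcτ : τ = c ^ 2 := by
    refine mul_right_cancel₀ (pow_ne_zero 2 (hu 0)) ?_
    rw [← hsq, hc, mul_pow]
  have hc0 : c ≠ 0 := by
    rintro rfl
    exact hτ (by simpa using hcτ)
  have q : ∀ j, t j = c * u j ∨ t j = -(c * u j) := by
    intro j
    rw [← sq_eq_sq_iff_eq_or_eq_neg, mul_pow, hsq, hcτ]
  have g0 := hg 0
  have g1 := h'.grad_zero
  simp only [grad, Matrix.cons_val] at g0 g1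
  -- All other terms of the first partial derivative depend on `t 0` and the squares only, so its
  -- vanishing determines this product and thereby the parity of the signs.
  have hm : t 1 * t 2 * t 3 = c ^ 3 * (u 1 * u 2 * u 3) := by
    refine mul_left_cancel₀ h.ne1 ?_
    rw [hc, hsq 1, hsq 2, hsq 3, hcτ] at g0
    linear_combination g0 - c ^ 3 * g1
  have bad : 2 * (c ^ 3 * (u 1 * u 2 * u 3)) ≠ 0 := by simp [hc0, hu]
  have fin : ∀ a, t = c • translate a 0 u →
      ∃ a, ∃ c : k, c ≠ 0 ∧ t = c • translate a 0 u := fun a ha => ⟨a, c, hc0, ha⟩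
  rcases q 1 with r1 | r1 <;> rcases q 2 with r2 | r2 <;> rcases q 3 with r3 | r3 <;>
    rw [r1, r2, r3] at hm
  · refine fin 0 (funext fun j => ?_)
    fin_cases j <;> simp [translate, sgn, vier, hc, r1, r2, r3]
  · exact absurd (by linear_combination -hm) bad
  · exact absurd (by linear_combination -hm) bad
  · refine fin 1 (funext fun j => ?_)
    fin_cases j <;> simp [translate, sgn, vier, hc, r1, r2, r3]
  · exact absurd (by linear_combination -hm) bad
  · refine fin 2 (funext fun j => ?_)
    fin_cases j <;> simp [translate, sgn, vier, hc, r1, r2, r3]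
  · refine fin 3 (funext fun j => ?_)
    fin_cases j <;> simp [translate, sgn, vier, hc, r1, r2, r3]
  · exact absurd (by linear_combination -hm) bad

/-! ### The coordinates of a node as roots of the given polynomials. -/

lemma firstPoly_eval [CharZero k] (h : IsParam v s γ δ ε) (r : k) :
    s 0 ^ 2 * s 1 ^ 2 * s 2 ^ 2 * s 3 ^ 2 * (firstPoly v).eval r = -(v 0 ^ 2 * v 1 ^ 2) *
      ((s 0 ^ 2 * r ^ 2 - s 1 ^ 2) * (s 1 ^ 2 * r ^ 2 - s 0 ^ 2) *
       ((s 2 ^ 2 * r ^ 2 - s 3 ^ 2) * (s 3 ^ 2 * r ^ 2 - s 2 ^ 2))) := by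
  have hB := h.sq_prod
  rw [← h.sq0, ← h.sq1, ← h.sq2, ← h.sq3] at hB
  have hP := mul_ne_zero (mul_ne_zero h.hγ h.hδ) h.hε
  rw [← eq_div_iff (pow_ne_zero 2 hP)] at hB
  have e2 := h.eq2
  have e3 := h.eq3
  have e4 := h.eq4
  rw [← eq_div_iff h.hγ] at e2
  rw [← eq_div_iff h.hδ] at e3
  rw [← eq_div_iff h.hε] at e4
  have b0 : 4 * (2 * v 0 * v 3 - v 2 * v 4) * (2 * v 0 * v 4 - v 2 * v 3) =
      64 * v 0 ^ 4 / ((1 - γ ^ 2) * (1 - δ ^ 2) * (1 - ε ^ 2)) ^ 2 *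
        ((s 0 ^ 4 + s 1 ^ 4) * (s 2 ^ 2 * s 3 ^ 2) + (s 2 ^ 4 + s 3 ^ 4) * (s 0 ^ 2 * s 1 ^ 2)) := by
    have h4 : ∀ x : k, x ^ 4 = (x ^ 2) ^ 2 := fun x => by ring
    rw [e2, e3, e4, h4 (s 0), h4 (s 1), h4 (s 2), h4 (s 3), h.sq0, h.sq1, h.sq2, h.sq3]
    have := h.hγ
    have := h.hδ
    have := h.hε
    field_simp
    ring
  have c0 : 2 * (2 * (v 4 ^ 2 + v 3 ^ 2) * (4 * v 0 ^ 2 + v 2 ^ 2) - 16 * v 0 * v 2 * v 3 * v 4) =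
      64 * v 0 ^ 4 / ((1 - γ ^ 2) * (1 - δ ^ 2) * (1 - ε ^ 2)) ^ 2 *
        (4 * (s 0 ^ 2 * s 1 ^ 2 * s 2 ^ 2 * s 3 ^ 2) +
          (s 0 ^ 4 + s 1 ^ 4) * (s 2 ^ 4 + s 3 ^ 4)) := by
    have h4 : ∀ x : k, x ^ 4 = (x ^ 2) ^ 2 := fun x => by ring
    rw [e2, e3, e4, h4 (s 0), h4 (s 1), h4 (s 2), h4 (s 3), h.sq0, h.sq1, h.sq2, h.sq3]
    have := h.hγ
    have := h.hδ
    have := h.hε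
    field_simp
    ring
  simp only [firstPoly, Polynomial.eval_add, Polynomial.eval_mul, Polynomial.eval_pow,
    Polynomial.eval_C, Polynomial.eval_X]
  rw [b0]
  have c1 : 2 * (v 0 ^ 2 * v 1 ^ 2 - 2 * (v 4 ^ 2 + v 3 ^ 2) * (4 * v 0 ^ 2 + v 2 ^ 2)
      + 16 * v 0 * v 2 * v 3 * v 4) = 2 * v 0 ^ 2 * v 1 ^ 2 -
      64 * v 0 ^ 4 / ((1 - γ ^ 2) * (1 - δ ^ 2) * (1 - ε ^ 2)) ^ 2 *
        (4 * (s 0 ^ 2 * s 1 ^ 2 * s 2 ^ 2 * s 3 ^ 2) +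
          (s 0 ^ 4 + s 1 ^ 4) * (s 2 ^ 4 + s 3 ^ 4)) := by
    linear_combination -c0
  rw [c1, hB]
  ring

/-- This is the homogenised form of the equation of `r₂`, with `r₁ = s 0 / s 1` and `r₂ = s 3 / s
1`. -/
lemma secondPoly_eq (h : IsParam v s γ δ ε) :
    (4 * v 0 ^ 2 - v 2 ^ 2) * (v 4 * s 0 ^ 2 - v 3 * s 1 ^ 2) * s 3 ^ 2 +
      (v 0 * ((4 * v 0 ^ 2 - v 2 ^ 2) * (s 0 ^ 4 - s 1 ^ 4) +
        (v 4 ^ 2 - v 3 ^ 2) * (s 0 ^ 4 + s 1 ^ 4)) +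
        v 2 * (v 4 ^ 2 - v 3 ^ 2) * (s 0 ^ 2 * s 1 ^ 2)) = 0 := by
  have e2 := h.eq2
  have e3 := h.eq3
  have e4 := h.eq4
  rw [← eq_div_iff h.hγ] at e2
  rw [← eq_div_iff h.hδ] at e3
  rw [← eq_div_iff h.hε] at e4
  have h4 : ∀ x : k, x ^ 4 = (x ^ 2) ^ 2 := fun x => by ring
  rw [e2, e3, e4, h4 (s 0), h4 (s 1), h.sq0, h.sq1, h.sq3]
  have := h.hγ
  have := h.hδ
  have := h.hε
  field_simp
  ring

/-- This is the homogenised form of the equation of `r₃ = s 2 / s 1`. It is linear in `s 2`, with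
leading coefficient nonzero by `four_sub_ne` and `ne_zero`. -/
lemma third_eq [CharZero k] (h : IsParam v s γ δ ε) :
    2 * (v 2 ^ 2 - 4 * v 0 ^ 2) * (s 0 * s 1 * s 2 * s 3) +
      v 1 * (v 2 * (s 0 ^ 2 * s 1 ^ 2) + v 0 * (s 0 ^ 4 + s 1 ^ 4)) = 0 := by
  have hP := mul_ne_zero (mul_ne_zero h.hγ h.hδ) h.hε
  have e1 := h.prod
  have e2 := h.eq2
  rw [← eq_div_iff hP] at e1
  rw [← eq_div_iff h.hγ] at e2
  have h4 : ∀ x : k, x ^ 4 = (x ^ 2) ^ 2 := fun x => by ring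
  rw [e1, e2, h4 (s 0), h4 (s 1), h.sq0, h.sq1]
  have := h.hγ
  have := h.hδ
  have := h.hε
  field_simp
  ring

/-- The value of `F_v` at the point `(s₁, -s₀, 0, 0)` of the plane dual to `s`. -/
lemma edge_eq (h : IsParam v s γ δ ε) :
    (v 0 * (s 0 ^ 4 + s 1 ^ 4) + v 2 * (s 0 ^ 2 * s 1 ^ 2)) * (1 - γ ^ 2) =
      4 * v 0 * γ ^ 2 * ((1 - δ ^ 2) * (1 - ε ^ 2)) := by
  have h4 : ∀ x : k, x ^ 4 = (x ^ 2) ^ 2 := fun x => by ring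
  rw [h4 (s 0), h4 (s 1), h.sq0, h.sq1]
  linear_combination ((γ * δ * ε + γ + δ + ε) * (γ * δ * ε + γ - δ - ε)) * h.eq2

lemma four_sub_ne [CharZero k] (h : IsParam v s γ δ ε) : 4 * v 0 ^ 2 - v 2 ^ 2 ≠ 0 := by
  intro h0
  have : -(16 * v 0 ^ 2 * γ ^ 2) = (4 * v 0 ^ 2 - v 2 ^ 2) * (1 - γ ^ 2) ^ 2 := by
    linear_combination (v 2 * (1 - γ ^ 2) + 2 * v 0 * (1 + γ ^ 2)) * h.eq2
  rw [h0, zero_mul] at this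
  simp [h.ne0, h.neγ] at this

/-- A root of the first polynomial is the quotient of the first two coordinates of a node. -/
lemma exists_translate_ratio [CharZero k] (h : IsParam v s γ δ ε) {r : k}
    (hr : (firstPoly v).IsRoot r) :
    ∃ a b, translate a b s 0 = r * translate a b s 1 := by
  have e := h.firstPoly_eval r
  rw [hr, mul_zero, eq_comm] at e
  simp only [mul_eq_zero, neg_eq_zero, pow_eq_zero_iff, h.ne0, h.ne1, ne_eq, OfNat.ofNat_ne_zero,
    not_false_eq_true, false_or] at e
  have q : ∀ x y : k, x ^ 2 * r ^ 2 - y ^ 2 = 0 → y = r * x ∨ -y = r * x := by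
    intro x y hxy
    have : y ^ 2 = (r * x) ^ 2 := by linear_combination -hxy
    rcases sq_eq_sq_iff_eq_or_eq_neg.1 this with h | h
    · exact .inl h
    · exact .inr (by rw [h, neg_neg])
  rcases e with (e | e) | (e | e) <;> rcases q _ _ e with e | e
  · exact ⟨0, 1, by simpa [translate, sgn, vier] using e⟩
  · exact ⟨2, 1, by simpa [translate, sgn, vier, neg_eq_iff_eq_neg] using e⟩
  · exact ⟨0, 0, by simpa [translate, sgn, vier] using e⟩
  · exact ⟨2, 0, by simpa [translate, sgn, vier, neg_eq_iff_eq_neg] using e⟩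
  · exact ⟨0, 3, by simpa [translate, sgn, vier] using e⟩
  · exact ⟨2, 3, by simpa [translate, sgn, vier, neg_eq_iff_eq_neg] using e⟩
  · exact ⟨0, 2, by simpa [translate, sgn, vier] using e⟩
  · exact ⟨2, 2, by simpa [translate, sgn, vier, neg_eq_iff_eq_neg] using e⟩

lemma exists_coordinates [CharZero k] (h : IsParam v s γ δ ε) {r₁ r₂ r₃ : k}
    (hr₁ : (firstPoly v).IsRoot r₁) (hlead : v 4 * r₁ ^ 2 - v 3 ≠ 0)
    (hr₂ : (secondPoly v r₁).IsRoot r₂)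
    (hr₃ : 2 * (v 2 ^ 2 - 4 * v 0 ^ 2) * r₃ * r₂ * r₁ + v 1 * v 2 * r₁ ^ 2 + v 0 * v 1
      + v 0 * v 1 * r₁ ^ 4 = 0) :
    ∃ (c γ' δ' ε' : k), c ≠ 0 ∧ IsParam v (c • ![r₁, 1, r₃, r₂]) γ' δ' ε' := by
  obtain ⟨a, b, hab⟩ := h.exists_translate_ratio hr₁
  obtain ⟨_, _, _, h'⟩ := h.exists_translate a b
  generalize translate a b s = u at *
  obtain ⟨c, hc⟩ : ∃ c, c = u 1 := ⟨_, rfl⟩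
  have hc0 : c ≠ 0 := hc ▸ h'.ne_zero 1
  have h0 : u 0 = c * r₁ := by rw [hab, hc, mul_comm]
  obtain ⟨t₂, h2⟩ : ∃ t, u 3 = c * t := ⟨u 3 / c, by field_simp⟩
  have e2 := h'.secondPoly_eq
  rw [← hc, h0, h2] at e2
  simp only [secondPoly, Polynomial.IsRoot.def, Polynomial.eval_add, Polynomial.eval_mul,
    Polynomial.eval_pow, Polynomial.eval_C, Polynomial.eval_X] at hr₂
  have sq : t₂ ^ 2 = r₂ ^ 2 := by
    refine mul_left_cancel₀ (mul_ne_zero (pow_ne_zero 4 hc0) (mul_ne_zero h'.four_sub_ne hlead)) ?_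
    linear_combination e2 - c ^ 4 * hr₂
  have key : ∃ (w : Fin 4 → k) (γ' δ' ε' : k), IsParam v w γ' δ' ε' ∧ w 1 = c ∧ w 0 = c * r₁ ∧
      w 3 = c * r₂ := by
    rcases sq_eq_sq_iff_eq_or_eq_neg.1 sq with rfl | e
    · exact ⟨u, _, _, _, h', hc.symm, h0, h2⟩
    -- The second polynomial fixes the last coordinate only up to sign. This translate reverses the
    -- last two coordinates and keeps the first two.
    · obtain ⟨_, _, _, h''⟩ := h'.exists_translate 1 0
      refine ⟨_, _, _, _, h'', ?_, ?_, ?_⟩ <;> simp [translate, sgn, vier, hc, h0, h2, e]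
  obtain ⟨w, γ', δ', ε', hw, w1, w0, w2⟩ := key
  refine ⟨c, γ', δ', ε', hc0, ?_⟩
  convert hw
  have e3 := hw.third_eq
  have nz := hw.ne_zero
  have n2 := nz 3
  have n0 := nz 0
  rw [w2] at n2
  rw [w0] at n0
  refine funext (forall_fin_four.2 ⟨?_, ?_, ?_, ?_⟩)
  · simp [w0]
  · simp [w1]
  · simp only [Pi.smul_apply, Matrix.cons_val, smul_eq_mul]
    rw [w0, w1, w2] at e3
    refine mul_left_cancel₀ (mul_ne_zero (mul_ne_zero n0 (mul_ne_zero hc0 n2)) hw.four_sub_ne) ?_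
    linear_combination (e3 - c ^ 4 * hr₃) / 2
  · simp [w2]

end IsParam

/-! ### Projective zero sets in terms of representatives. -/

lemma eval_smul_of_isHomogeneous {f : MvPolynomial (Fin 4) k} {n : ℕ} (hf : f.IsHomogeneous n)
    (c : k) (s : Fin 4 → k) : eval (c • s) f = c ^ n * eval s f := by
  rw [eval_eq, eval_eq, Finset.mul_sum]
  refine Finset.sum_congr rfl fun d hd => ?_
  rw [hf.degree_eq_sum_deg_support hd]
  simp [mul_pow, Finset.prod_mul_distrib, Finset.prod_pow_eq_pow_sum]
  ring

lemma mem_zeroLocus_iff {S : Set (MvPolynomial (Fin 4) k)}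
    (hS : ∀ f ∈ S, ∃ n, f.IsHomogeneous n) (s : Fin 4 → k) (hs : s ≠ 0) :
    .mk k s hs ∈ zeroLocus S ↔ ∀ f ∈ S, eval s f = 0 := by
  refine forall₂_congr fun f hf => ?_
  obtain ⟨n, hn⟩ := hS f hf
  rw [Projectivization.submodule_mk]
  constructor
  · exact fun h => h s (Submodule.mem_span_singleton_self s)
  · intro h u hu
    obtain ⟨a, rfl⟩ := Submodule.mem_span_singleton.1 hu
    rw [eval_smul_of_isHomogeneous hn, h, mul_zero]

lemma isSingularPoint_quartic_iff [CharZero k] (v : Fin 5 → k) (s : Fin 4 → k) (hs : s ≠ 0) :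
    IsSingularPoint (quartic v) (.mk k s hs) ↔ ∀ j, grad v s j = 0 := by
  have hF := quartic_isHomogeneous v
  rw [IsSingularPoint, mem_zeroLocus_iff (by rintro _ rfl; exact ⟨4, hF⟩)]
  have : ∀ j, .mk k s hs ∈ zeroLocus {pderiv j (quartic v)} ↔ grad v s j = 0 := by
    intro j
    rw [mem_zeroLocus_iff (by rintro _ rfl; exact ⟨3, hF.pderiv⟩)]
    simp [eval_pderiv_quartic]
  simp only [this, Set.mem_singleton_iff, forall_eq, and_iff_right_iff_imp]
  intro h
  have := eval_quartic_eq_sum_grad v s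
  simpa [h] using this

/-! ### Fifteen hyperplanes of singular quartics, and the planes of the Segre cubic. -/

lemma facet_zero {p : Fin 5 → k} (hp : ∀ s ≠ 0, ∃ j, grad p s j ≠ 0) : p 0 ≠ 0 := by
  intro h
  obtain ⟨j, hj⟩ := hp ![1, 0, 0, 0] (fun h => by simpa using congrFun h 0)
  revert hj
  fin_cases j <;> simp [grad, h]

lemma facet_two [IsAlgClosed k] {p : Fin 5 → k} (hp : ∀ s ≠ 0, ∃ j, grad p s j ≠ 0)
    {x : k} (hx : x ^ 2 = 1) :
    2 * p 0 + x * p 2 ≠ 0 ∧ 2 * p 0 + x * p 3 ≠ 0 ∧ 2 * p 0 + x * p 4 ≠ 0 := by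
  obtain ⟨τ, hτ⟩ := IsAlgClosed.exists_pow_nat_eq x two_pos
  refine ⟨fun h => ?_, fun h => ?_, fun h => ?_⟩
  · obtain ⟨j, hj⟩ := hp ![τ, 1, 0, 0] (fun h => by simpa using congrFun h 1)
    apply hj
    fin_cases j <;> simp [grad]
    · linear_combination 2 * τ * x * h - 2 * τ * p 2 * hx + 4 * p 0 * τ * hτ
    · linear_combination 2 * h + 2 * p 2 * hτ
  · obtain ⟨j, hj⟩ := hp ![τ, 0, 1, 0] (fun h => by simpa using congrFun h 2)
    apply hj
    fin_cases j <;> simp [grad]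
    · linear_combination 2 * τ * x * h - 2 * τ * p 3 * hx + 4 * p 0 * τ * hτ
    · linear_combination 2 * h + 2 * p 3 * hτ
  · obtain ⟨j, hj⟩ := hp ![τ, 0, 0, 1] (fun h => by simpa using congrFun h 3)
    apply hj
    fin_cases j <;> simp [grad]
    · linear_combination 2 * τ * x * h - 2 * τ * p 4 * hx + 4 * p 0 * τ * hτ
    · linear_combination 2 * h + 2 * p 4 * hτ

/-- Otherwise `(1, a, b, c)` with `a² = x`, `b² = y`, `c² = x y` and `a b c = σ` would be a singular
point. -/
lemma facet_four [IsAlgClosed k] {p : Fin 5 → k} (hp : ∀ s ≠ 0, ∃ j, grad p s j ≠ 0)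
    {σ x y : k} (hσ : σ ^ 2 = 1) (hx : x ^ 2 = 1) (hy : y ^ 2 = 1) :
    4 * p 0 + σ * p 1 + 2 * (x * p 2 + y * p 3 + x * y * p 4) ≠ 0 := by
  intro h
  obtain ⟨a, ha⟩ := IsAlgClosed.exists_pow_nat_eq x two_pos
  obtain ⟨b, hb⟩ := IsAlgClosed.exists_pow_nat_eq y two_pos
  obtain ⟨c, hc⟩ : ∃ c, c = σ * (a * b) * (x * y) := ⟨_, rfl⟩
  have hc2 : c ^ 2 = x * y := by
    rw [hc]
    simp only [mul_pow, hσ, hx, hy, ha, hb]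
    ring
  have habc : a * b * c = σ := by
    rw [hc]
    linear_combination σ * b ^ 2 * x * y * ha + σ * x ^ 2 * y * hb + σ * y ^ 2 * hx + σ * hy
  obtain ⟨j, hj⟩ := hp ![1, a, b, c] (fun h => by simpa using congrFun h 0)
  have hbc : b * c = σ * a * x := by
    linear_combination -b * c * hx - b * c * x * ha + a * x * habc
  have hac : a * c = σ * b * y := by
    linear_combination -a * c * hy - a * c * y * hb + b * y * habc
  have hab : a * b = σ * c * (x * y) := by
    linear_combination -a * b * (x ^ 2 * hy + hx) - a * b * (x * y) * hc2 + c * (x * y) * habc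
  apply hj
  fin_cases j <;> simp [grad]
  · linear_combination h + p 1 * habc + 2 * p 2 * ha + 2 * p 3 * hb + 2 * p 4 * hc2
  · linear_combination a * x * h + 4 * p 0 * a * ha + p 1 * hbc + 2 * a * p 3 * hc2 +
      2 * a * p 4 * hb - 2 * a * p 2 * hx - 2 * a * p 4 * y * hx
  · linear_combination b * y * h + 4 * p 0 * b * hb + p 1 * hac + 2 * b * p 2 * hc2 +
      2 * b * p 4 * ha - 2 * b * p 3 * hy - 2 * b * p 4 * x * hy
  · linear_combination c * (x * y) * h + 4 * p 0 * c * hc2 + p 1 * hab + 2 * c * p 2 * hb +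
      2 * c * p 3 * ha - 2 * c * p 2 * y * hx - 2 * c * p 3 * x * hy -
      2 * c * p 4 * (x ^ 2 * hy + hx)

/-- Here, and in the three lemmas that follow, the three linear forms all vanish on one plane of the
Segre cubic. A line joining a node to a point of that plane therefore stays in one of the three
hyperplanes. -/
lemma node_facet_zero [CharZero k] (i : Fin 10) (j : Fin 5) (hj : j = 2 ∨ j = 3 ∨ j = 4) :
    node k i 0 = 0 ∨ 2 * node k i 0 + 1 * node k i j = 0 ∨
      2 * node k i 0 + (-1) * node k i j = 0 := by
  rcases hj with rfl | rfl | rfl <;> fin_cases i <;> simp [node]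

lemma node_facet_two [CharZero k] (i : Fin 10) {x τ : k} (hx : x ^ 2 = 1) (hτ : τ ^ 2 = 1) :
    2 * node k i 0 + x * node k i 2 = 0 ∨
    4 * node k i 0 + 1 * node k i 1
      + 2 * (x * node k i 2 + (-τ) * node k i 3 + x * (-τ) * node k i 4) = 0 ∨
    4 * node k i 0 + (-1) * node k i 1
      + 2 * (x * node k i 2 + τ * node k i 3 + x * τ * node k i 4) = 0 := by
  rcases sq_eq_one_iff.1 hx with rfl | rfl <;> rcases sq_eq_one_iff.1 hτ with rfl | rfl <;>
    fin_cases i <;> simp [node] <;> norm_num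

lemma node_facet_three [CharZero k] (i : Fin 10) {x τ : k} (hx : x ^ 2 = 1) (hτ : τ ^ 2 = 1) :
    2 * node k i 0 + x * node k i 3 = 0 ∨
    4 * node k i 0 + 1 * node k i 1
      + 2 * ((-τ) * node k i 2 + x * node k i 3 + (-τ) * x * node k i 4) = 0 ∨
    4 * node k i 0 + (-1) * node k i 1
      + 2 * (τ * node k i 2 + x * node k i 3 + τ * x * node k i 4) = 0 := by
  rcases sq_eq_one_iff.1 hx with rfl | rfl <;> rcases sq_eq_one_iff.1 hτ with rfl | rfl <;>
    fin_cases i <;> simp [node] <;> norm_num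

lemma node_facet_four [CharZero k] (i : Fin 10) {x τ : k} (hx : x ^ 2 = 1) (hτ : τ ^ 2 = 1) :
    2 * node k i 0 + x * node k i 4 = 0 ∨
    4 * node k i 0 + 1 * node k i 1
      + 2 * ((-τ) * node k i 2 + (-(τ * x)) * node k i 3 + (-τ) * (-(τ * x)) * node k i 4) = 0 ∨
    4 * node k i 0 + (-1) * node k i 1
      + 2 * (τ * node k i 2 + (τ * x) * node k i 3 + τ * (τ * x) * node k i 4) = 0 := by
  rcases sq_eq_one_iff.1 hx with rfl | rfl <;> rcases sq_eq_one_iff.1 hτ with rfl | rfl <;>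
    fin_cases i <;> simp [node] <;> norm_num

/-- The third point on the line through `q_i` and `p` is in none of the fifteen planes that the Segre
cubic contains. -/
lemma thirdPoint_facet [IsAlgClosed k] [CharZero k] {p v : Fin 5 → k} {i : Fin 10} {β Δ : k}
    (hp : ∀ s ≠ 0, ∃ j, grad p s j ≠ 0) (hβ0 : β ≠ 0)
    (hβ : ∀ j, β * p j = Δ * node k i j + v j) (hv : segre v = 0) :
    v 0 ≠ 0 ∧ ∀ x : k, x ^ 2 = 1 →
      2 * v 0 + x * v 2 ≠ 0 ∧ 2 * v 0 + x * v 3 ≠ 0 ∧ 2 * v 0 + x * v 4 ≠ 0 := by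
  have c0 := hβ 0
  have c1 := hβ 1
  have c2 := hβ 2
  have c3 := hβ 3
  have c4 := hβ 4
  have p0 := facet_zero hp
  have one : (1 : k) ^ 2 = 1 := one_pow 2
  have none : (-1 : k) ^ 2 = 1 := by ring
  have cancel : ∀ y : k, β * y = 0 → y = 0 := fun y h => (mul_eq_zero.1 h).resolve_left hβ0
  have v0 : v 0 ≠ 0 := by
    intro h
    have : v 2 * v 3 * v 4 = 0 := by
      rw [segre, h] at hv
      linear_combination hv / 4
    obtain ⟨a1, a2, a3⟩ := facet_two hp one
    obtain ⟨b1, b2, b3⟩ := facet_two hp none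
    rcases mul_eq_zero.1 this with this | this
    · rcases mul_eq_zero.1 this with this | this
      · rcases node_facet_zero (k := k) i 2 (by simp) with h' | h' | h'
        · exact p0 (cancel _ (by linear_combination c0 + h + Δ * h'))
        · exact a1 (cancel _ (by linear_combination 2 * c0 + c2 + 2 * h + this + Δ * h'))
        · exact b1 (cancel _ (by linear_combination 2 * c0 - c2 + 2 * h - this + Δ * h'))
      · rcases node_facet_zero (k := k) i 3 (by simp) with h' | h' | h'
        · exact p0 (cancel _ (by linear_combination c0 + h + Δ * h'))
        · exact a2 (cancel _ (by linear_combination 2 * c0 + c3 + 2 * h + this + Δ * h'))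
        · exact b2 (cancel _ (by linear_combination 2 * c0 - c3 + 2 * h - this + Δ * h'))
    · rcases node_facet_zero (k := k) i 4 (by simp) with h' | h' | h'
      · exact p0 (cancel _ (by linear_combination c0 + h + Δ * h'))
      · exact a3 (cancel _ (by linear_combination 2 * c0 + c4 + 2 * h + this + Δ * h'))
      · exact b3 (cancel _ (by linear_combination 2 * c0 - c4 + 2 * h - this + Δ * h'))
  have sg : ∀ y : k, v 1 ^ 2 = (2 * y) ^ 2 → ∃ τ : k, τ ^ 2 = 1 ∧ v 1 = 2 * τ * y := by
    intro y hy
    rcases sq_eq_sq_iff_eq_or_eq_neg.1 hy with h | h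
    · exact ⟨1, one, by rw [h]; ring⟩
    · exact ⟨-1, none, by rw [h]; ring⟩
  have neg : ∀ {τ : k}, τ ^ 2 = 1 → (-τ) ^ 2 = 1 := fun h => by rw [neg_sq, h]
  refine ⟨v0, fun x hx => ?_⟩
  obtain ⟨a1, a2, a3⟩ := facet_two hp hx
  refine ⟨fun h => ?_, fun h => ?_, fun h => ?_⟩
  -- On the hyperplane `2A + xC = 0` the Segre cubic is `A (B² - 4 (D + xE)²)`, so it splits into
  -- planes.
  · obtain ⟨τ, hτ, e⟩ := sg (v 3 + x * v 4) (by
      refine mul_left_cancel₀ v0 ?_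
      have e : v 2 = -2 * x * v 0 := by linear_combination x * h - v 2 * hx
      rw [segre, e] at hv
      linear_combination hv + 16 * v 0 ^ 3 * hx - 4 * v 0 * v 4 ^ 2 * hx)
    rcases node_facet_two i hx hτ with h' | h' | h'
    · exact a1 (cancel _ (by linear_combination 2 * c0 + x * c2 + h + Δ * h'))
    · exact facet_four hp one hx (neg hτ) (cancel _ (by
        linear_combination 4 * c0 + c1 + 2 * (x * c2 - τ * c3 - x * τ * c4) + Δ * h' + 2 * h + e))
    · exact facet_four hp none hx hτ (cancel _ (by
        linear_combination 4 * c0 - c1 + 2 * (x * c2 + τ * c3 + x * τ * c4) + Δ * h' + 2 * h - e))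
  · obtain ⟨τ, hτ, e⟩ := sg (v 2 + x * v 4) (by
      refine mul_left_cancel₀ v0 ?_
      have e : v 3 = -2 * x * v 0 := by linear_combination x * h - v 3 * hx
      rw [segre, e] at hv
      linear_combination hv + 16 * v 0 ^ 3 * hx - 4 * v 0 * v 4 ^ 2 * hx)
    rcases node_facet_three i hx hτ with h' | h' | h'
    · exact a2 (cancel _ (by linear_combination 2 * c0 + x * c3 + h + Δ * h'))
    · exact facet_four hp one (neg hτ) hx (cancel _ (by
        linear_combination 4 * c0 + c1 + 2 * (x * c3 - τ * c2 - x * τ * c4) + Δ * h' + 2 * h + e))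
    · exact facet_four hp none hτ hx (cancel _ (by
        linear_combination 4 * c0 - c1 + 2 * (x * c3 + τ * c2 + x * τ * c4) + Δ * h' + 2 * h - e))
  · obtain ⟨τ, hτ, e⟩ := sg (v 2 + x * v 3) (by
      refine mul_left_cancel₀ v0 ?_
      have e : v 4 = -2 * x * v 0 := by linear_combination x * h - v 4 * hx
      rw [segre, e] at hv
      linear_combination hv + 16 * v 0 ^ 3 * hx - 4 * v 0 * v 3 ^ 2 * hx)
    have hτx : (τ * x) ^ 2 = 1 := by rw [mul_pow, hτ, hx, one_mul]
    rcases node_facet_four i hx hτ with h' | h' | h'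
    · exact a3 (cancel _ (by linear_combination 2 * c0 + x * c4 + h + Δ * h'))
    · exact facet_four hp one (neg hτ) (neg hτx) (cancel _ (by
        linear_combination 4 * c0 + c1 + 2 * (τ ^ 2 * x * c4 - τ * c2 - x * τ * c3) + Δ * h' +
          2 * h + e + 2 * x * v 4 * hτ))
    · exact facet_four hp none hτ hτx (cancel _ (by
        linear_combination 4 * c0 - c1 + 2 * (τ ^ 2 * x * c4 + τ * c2 + x * τ * c3) + Δ * h' +
          2 * h - e + 2 * x * v 4 * hτ))

/-! ### Conics in plane sections of a smooth quartic. -/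

/-- A form in two variables over an algebraically closed field has a nontrivial zero. -/
lemma exists_zero_of_isHomogeneous [IsAlgClosed k] {h : MvPolynomial (Fin 4) k} {n : ℕ}
    (hh : h.IsHomogeneous n) (hn : n ≠ 0) (e f : Fin 4 → k) :
    ∃ a b : k, (a ≠ 0 ∨ b ≠ 0) ∧ eval (a • e + b • f) h = 0 := by
  have lift : ∀ e f : Fin 4 → k, ∃ P : Polynomial k, ∀ t, P.eval t = eval (e + t • f) h := by
    intro e f
    refine ⟨aeval (fun j => Polynomial.C (e j) + Polynomial.X * Polynomial.C (f j)) h, fun t => ?_⟩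
    rw [← Polynomial.coe_aeval_eq_eval, ← AlgHom.comp_apply, comp_aeval, aeval_eq_eval]
    congr 2
    ext j
    simp
    exact mul_comm _ _
  obtain ⟨P, hP⟩ := lift e f
  obtain ⟨Q, hQ⟩ := lift f e
  -- If `h (e + t f)` is a nonzero constant `c`, then `h (f + x e) = c xⁿ`, so `f` itself is a zero.
  by_cases hd : P.degree = 0
  · obtain ⟨c, hc⟩ : ∃ c, P = Polynomial.C c := ⟨_, Polynomial.eq_C_of_degree_eq_zero hd⟩
    -- The factor `X` makes the identity trivial at `0`, where the scaling argument is not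
    -- available.
    have key : Q * Polynomial.X = Polynomial.C c * Polynomial.X ^ n * Polynomial.X := by
      refine Polynomial.funext fun x => ?_
      by_cases hx : x = 0
      · simp [hx]
      · have : f + x • e = x • (e + x⁻¹ • f) := by
          rw [smul_add, smul_smul, mul_inv_cancel₀ hx, one_smul, add_comm]
        simp only [Polynomial.eval_mul, Polynomial.eval_X, Polynomial.eval_C, Polynomial.eval_pow]
        rw [hQ, this, eval_smul_of_isHomogeneous hh, ← hP, hc, Polynomial.eval_C]
        ring
    have := mul_right_cancel₀ Polynomial.X_ne_zero key
    refine ⟨0, 1, .inr one_ne_zero, ?_⟩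
    have h0 := hQ 0
    rw [this] at h0
    simpa [hn] using h0.symm
  · obtain ⟨z, hz⟩ := IsAlgClosed.exists_root P hd
    refine ⟨1, z, .inl one_ne_zero, ?_⟩
    rw [one_smul, ← hP]
    exact hz

lemma exists_zero_mem [IsAlgClosed k] {h : MvPolynomial (Fin 4) k} {n : ℕ}
    (hh : h.IsHomogeneous n) (hn : n ≠ 0) {W : Submodule k (Fin 4 → k)}
    (hW : 1 < Module.finrank k W) : ∃ x ∈ W, x ≠ 0 ∧ eval x h = 0 := by
  have : Nontrivial W := Module.nontrivial_of_finrank_pos (R := k) (by omega)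
  obtain ⟨e, he⟩ := exists_ne (0 : W)
  obtain ⟨f, hf⟩ := exists_linearIndependent_pair_of_one_lt_finrank hW he
  obtain ⟨a, b, hab, h0⟩ := exists_zero_of_isHomogeneous hh hn (e : Fin 4 → k) f
  refine ⟨a • e + b • f, W.add_mem (W.smul_mem _ e.2) (W.smul_mem _ f.2), fun h => ?_, h0⟩
  obtain ⟨rfl, rfl⟩ := LinearIndependent.pair_iff.1 hf a b (Subtype.ext (by simpa using h))
  simp at hab

/-- The derivative of `f` at `x` in the direction `y`. -/
noncomputable def dirDeriv (f : MvPolynomial (Fin 4) k) (x y : Fin 4 → k) : k :=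
  ∑ j, y j * eval x (pderiv j f)

lemma dirDeriv_add (f g : MvPolynomial (Fin 4) k) (x y : Fin 4 → k) :
    dirDeriv (f + g) x y = dirDeriv f x y + dirDeriv g x y := by
  simp [dirDeriv, mul_add, Finset.sum_add_distrib]

lemma dirDeriv_mul (f g : MvPolynomial (Fin 4) k) (x y : Fin 4 → k) :
    dirDeriv (f * g) x y = dirDeriv f x y * eval x g + eval x f * dirDeriv g x y := by
  simp only [dirDeriv, Derivation.leibniz, smul_eq_mul, map_add, map_mul, mul_add,
    Finset.sum_add_distrib, Finset.sum_mul, Finset.mul_sum]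
  rw [add_comm]
  congr 1 <;> exact Finset.sum_congr rfl fun j _ => by ring

lemma dirDeriv_C_mul (c : k) (f : MvPolynomial (Fin 4) k) (x y : Fin 4 → k) :
    dirDeriv (C c * f) x y = c * dirDeriv f x y := by
  rw [dirDeriv_mul]
  simp [dirDeriv]

lemma dirDeriv_add_smul (f : MvPolynomial (Fin 4) k) (x y z : Fin 4 → k) (c : k) :
    dirDeriv f x (y + c • z) = dirDeriv f x y + c * dirDeriv f x z := by
  simp [dirDeriv, add_mul, Finset.sum_add_distrib, Finset.mul_sum, mul_assoc]

lemma dirDeriv_single (f : MvPolynomial (Fin 4) k) (x : Fin 4 → k) (j : Fin 4) :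
    dirDeriv f x (Pi.single j 1) = eval x (pderiv j f) := by
  simp [dirDeriv, Pi.single_apply]

lemma eval_linearForm (t x : Fin 4 → k) : eval x (linearForm t) = t ⬝ᵥ x := by
  simp [linearForm, dotProduct]

lemma pderiv_linearForm (t : Fin 4 → k) (j : Fin 4) : pderiv j (linearForm t) = C (t j) := by
  simp [linearForm, pderiv_X, Pi.single_apply]

lemma dirDeriv_linearForm (t x y : Fin 4 → k) : dirDeriv (linearForm t) x y = t ⬝ᵥ y := by
  simp [dirDeriv, pderiv_linearForm, dotProduct, mul_comm]

lemma linearForm_isHomogeneous {R : Type*} [CommRing R] (t : Fin 4 → R) :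
    (linearForm t).IsHomogeneous 1 :=
  IsHomogeneous.sum _ _ _ fun _ _ => isHomogeneous_C_mul_X _ _

/-- A smooth quartic surface `κ g g' + l T = 0` meets the plane `T = 0` in no double line. -/
lemma false_of_double_line [IsAlgClosed k] {F g g' l : MvPolynomial (Fin 4) k} {κ : k}
    {t : Fin 4 → k} (ht : t ≠ 0) (hF4 : F.IsHomogeneous 4)
    (hF : ∀ s ≠ 0, ∃ j, eval s (pderiv j F) ≠ 0) (hFg : F = C κ * (g * g') + l * linearForm t)
    {W : Submodule k (Fin 4 → k)} (hW : 1 < Module.finrank k W) (hWt : ∀ x ∈ W, t ⬝ᵥ x = 0)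
    (hWg : ∀ x ∈ W, eval x g = 0) (hWd : ∀ x ∈ W, ∀ y, t ⬝ᵥ y = 0 → dirDeriv g x y = 0) :
    False := by
  obtain ⟨j, hj⟩ := Function.ne_iff.1 ht
  obtain ⟨n, hn⟩ : ∃ n : Fin 4 → k, t ⬝ᵥ n = 1 :=
    ⟨Pi.single j (t j)⁻¹, by simpa using mul_inv_cancel₀ hj⟩
  -- Along the double line all derivatives in directions of the plane vanish. Only the one along the
  -- transversal `n` remains, a cubic form that has a zero on the line.
  have hom : (∑ j, C (n j) * pderiv j F).IsHomogeneous 3 :=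
    IsHomogeneous.sum _ _ _ fun j _ => (hF4.pderiv (i := j)).C_mul _
  obtain ⟨x, hxW, hx0, hx⟩ := exists_zero_mem hom (by norm_num) hW
  have hxn : dirDeriv F x n = 0 := by simpa [dirDeriv] using hx
  have hd : ∀ y, t ⬝ᵥ y = 0 → dirDeriv F x y = 0 := by
    intro y hy
    rw [hFg, dirDeriv_add, dirDeriv_C_mul, dirDeriv_mul, dirDeriv_mul, dirDeriv_linearForm,
      eval_linearForm, hWt x hxW, hWg x hxW, hWd x hxW y hy, hy]
    ring
  obtain ⟨i, hi⟩ := hF x hx0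
  apply hi
  rw [← dirDeriv_single]
  have : (Pi.single i 1 : Fin 4 → k) = (Pi.single i 1 + (-t i) • n) + t i • n := by simp
  rw [this, dirDeriv_add_smul, hxn, hd]
  · simp
  · rw [dotProduct_add, dotProduct_smul, hn]
    simp

/-- `f` is a quadratic form, as a function on `k⁴`. -/
structure IsQuadratic (f : MvPolynomial (Fin 4) k) : Prop where
  hom : f.IsHomogeneous 2
  polar : ∀ x y, eval (x + y) f = eval x f + eval y f + dirDeriv f x y

lemma IsQuadratic.add {f g : MvPolynomial (Fin 4) k} (hf : IsQuadratic f) (hg : IsQuadratic g) :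
    IsQuadratic (f + g) := by
  refine ⟨hf.hom.add hg.hom, fun x y => ?_⟩
  rw [map_add, map_add, map_add, dirDeriv_add, hf.polar, hg.polar]
  ring

lemma IsQuadratic.C_mul {f : MvPolynomial (Fin 4) k} (hf : IsQuadratic f) (c : k) :
    IsQuadratic (C c * f) := by
  refine ⟨hf.hom.C_mul c, fun x y => ?_⟩
  simp only [map_mul, eval_C, dirDeriv_C_mul, hf.polar]
  ring

lemma nodeQuadric_isHomogeneous {R : Type*} [CommRing R] (i : Fin 10) :
    (nodeQuadric R i).IsHomogeneous 2 := by
  have hX : ∀ i j : Fin 4, (X i * X j : MvPolynomial (Fin 4) R).IsHomogeneous 2 :=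
    fun i j => (isHomogeneous_X R i).mul (isHomogeneous_X R j)
  have hX2 : ∀ i : Fin 4, (X i ^ 2 : MvPolynomial (Fin 4) R).IsHomogeneous 2 :=
    fun i => isHomogeneous_X_pow i 2
  fin_cases i
  · exact (((hX2 0).sub (hX2 1)).sub (hX2 2)).add (hX2 3)
  · exact (((hX2 0).sub (hX2 1)).add (hX2 2)).sub (hX2 3)
  · exact (((hX2 0).add (hX2 1)).sub (hX2 2)).sub (hX2 3)
  · exact (((hX2 0).add (hX2 1)).add (hX2 2)).add (hX2 3)
  · exact (hX 0 1).sub (hX 2 3)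
  · exact (hX 0 1).add (hX 2 3)
  · exact (hX 0 2).sub (hX 1 3)
  · exact (hX 0 2).add (hX 1 3)
  · exact (hX 0 3).sub (hX 1 2)
  · exact (hX 0 3).add (hX 1 2)

lemma nodeQuadric_isQuadratic (i : Fin 10) : IsQuadratic (nodeQuadric k i) := by
  refine ⟨nodeQuadric_isHomogeneous i, fun x y => ?_⟩
  fin_cases i <;> simp [nodeQuadric, dirDeriv, Fin.sum_univ_four, pderiv_X] <;> ring

/-- The diagonal quadratic form `∑ nⱼ xⱼ²`. -/
noncomputable def diag {R : Type*} [CommRing R] (n : Fin 4 → R) : MvPolynomial (Fin 4) R :=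
  ∑ j, C (n j) * X j ^ 2

lemma diag_isQuadratic (n : Fin 4 → k) : IsQuadratic (diag n) := by
  refine ⟨IsHomogeneous.sum _ _ _ fun j _ => isHomogeneous_C_mul_X_pow _ _ _, fun x y => ?_⟩
  simp [diag, dirDeriv, Fin.sum_univ_four, pderiv_X]
  ring

/-- The hyperplane of vectors orthogonal to `t`. -/
def hyperplane (t : Fin 4 → k) : Submodule k (Fin 4 → k) where
  carrier := {x | t ⬝ᵥ x = 0}
  add_mem' := by
    intro x y hx hy
    simp only [Set.mem_ofPred_eq] at *
    rw [dotProduct_add, hx, hy, add_zero]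
  zero_mem' := dotProduct_zero t
  smul_mem' := by
    intro c x hx
    simp only [Set.mem_ofPred_eq] at *
    rw [dotProduct_smul, hx, smul_zero]

lemma mem_hyperplane {t x : Fin 4 → k} : x ∈ hyperplane t ↔ t ⬝ᵥ x = 0 := Iff.rfl

lemma finrank_hyperplane (t : Fin 4 → k) : 3 ≤ Module.finrank k (hyperplane t) := by
  let φ : (Fin 4 → k) →ₗ[k] k :=
    { toFun := fun x => t ⬝ᵥ x
      map_add' := dotProduct_add t
      map_smul' := fun c x => dotProduct_smul c t x }
  have h1 := LinearMap.finrank_range_add_finrank_ker φ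
  have h2 : LinearMap.ker φ = hyperplane t := by
    ext x
    rfl
  have h3 : Module.finrank k (LinearMap.range φ) ≤ 1 := by
    simpa using Submodule.finrank_le (LinearMap.range φ)
  rw [h2] at h1
  simp only [Module.finrank_fintype_fun_eq_card, Fintype.card_fin] at h1
  omega

lemma finrank_inf_hyperplane (t : Fin 4 → k) {W : Submodule k (Fin 4 → k)}
    (hW : 3 ≤ Module.finrank k W) : 1 < Module.finrank k ↥(hyperplane t ⊓ W) := by
  have h1 := Submodule.finrank_sup_add_finrank_inf_eq (hyperplane t) W
  have h2 := finrank_hyperplane t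
  have h3 := Submodule.finrank_le (hyperplane t ⊔ W)
  simp only [Module.finrank_fintype_fun_eq_card, Fintype.card_fin] at h3
  omega

section Conic

variable [IsAlgClosed k] {F g g' l : MvPolynomial (Fin 4) k} {κ : k} {t : Fin 4 → k}

/-- The conic `g = 0` does not contain the whole plane. -/
lemma exists_eval_ne_zero (ht : t ≠ 0) (hF4 : F.IsHomogeneous 4)
    (hF : ∀ s ≠ 0, ∃ j, eval s (pderiv j F) ≠ 0) (hFg : F = C κ * (g * g') + l * linearForm t)
    (hg : IsQuadratic g) : ∃ x, t ⬝ᵥ x = 0 ∧ eval x g ≠ 0 := by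
  by_contra! h
  refine false_of_double_line (W := hyperplane t) ht hF4 hF hFg ?_ (fun x hx => hx)
    (fun x hx => h x hx) ?_
  · have := finrank_hyperplane t
    omega
  · intro x hx y hy
    have := hg.polar x y
    rw [h x hx, h y hy, h (x + y) (by rw [dotProduct_add, mem_hyperplane.1 hx, hy, add_zero])]
      at this
    simpa using this.symm

/-- The conic `g = 0` in the plane dual to `t` is not contained in another plane. -/
lemma exists_eq_smul_of_subset (ht : ∀ j, t j ≠ 0) (hF4 : F.IsHomogeneous 4)
    (hF : ∀ s ≠ 0, ∃ j, eval s (pderiv j F) ≠ 0) (hFg : F = C κ * (g * g') + l * linearForm t)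
    (hg : IsQuadratic g) {t' : Fin 4 → k}
    (h : ∀ x ≠ 0, t ⬝ᵥ x = 0 → eval x g = 0 → t' ⬝ᵥ x = 0) : ∃ c : k, t' = c • t := by
  by_contra! hc
  have he : ∃ e, t ⬝ᵥ e = 0 ∧ t' ⬝ᵥ e ≠ 0 := by
    by_contra! he
    apply hc (t' 0 / t 0)
    ext j
    have := he (Pi.single 0 (t j) + Pi.single j (-t 0)) (by
      simp only [dotProduct_add, dotProduct_single]; ring)
    simp only [dotProduct_add, dotProduct_single] at this
    have h0 := ht 0
    simp only [Pi.smul_apply, smul_eq_mul]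
    field_simp
    linear_combination -this
  obtain ⟨e, he, he'⟩ := he
  have h' : ∀ x, t ⬝ᵥ x = 0 → eval x g = 0 → t' ⬝ᵥ x = 0 := by
    intro x
    by_cases hx : x = 0
    · simp [hx]
    · exact h x hx
  -- The join of `e` and `w` meets the conic, and by assumption only where `t'` vanishes, that is,
  -- at `w`. If the derivative towards `e` were nonzero there, the join would contain a further
  -- point of the conic with `t' ≠ 0`.
  have hW : ∀ w, t ⬝ᵥ w = 0 → t' ⬝ᵥ w = 0 → eval w g = 0 ∧ dirDeriv g w e = 0 := by
    intro w hw hw'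
    have h0 : eval w g = 0 := by
      obtain ⟨a, b, hab, h0⟩ := exists_zero_of_isHomogeneous hg.hom two_ne_zero e w
      have h1 := h' _ (by simp [dotProduct_add, dotProduct_smul, he, hw]) h0
      simp only [dotProduct_add, dotProduct_smul, hw', mul_zero, add_zero, smul_eq_mul,
        mul_eq_zero, he', or_false] at h1
      subst h1
      have hb : b ≠ 0 := by simpa using hab
      rw [zero_smul, zero_add, eval_smul_of_isHomogeneous hg.hom] at h0
      exact (mul_eq_zero.1 h0).resolve_left (pow_ne_zero 2 hb)
    refine ⟨h0, ?_⟩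
    by_contra hd
    have h1 := hg.polar ((-eval e g / dirDeriv g w e) • w) e
    have h2 : dirDeriv g ((-eval e g / dirDeriv g w e) • w) e = -eval e g := by
      have h3 : ∀ c : k, dirDeriv g (c • w) e = c * dirDeriv g w e := by
        intro c
        simp only [dirDeriv, Finset.mul_sum]
        refine Finset.sum_congr rfl fun j _ => ?_
        rw [eval_smul_of_isHomogeneous (hg.hom.pderiv (i := j))]
        ring
      rw [h3]
      field_simp
    rw [h2, eval_smul_of_isHomogeneous hg.hom, h0] at h1
    have h4 := h' _ (by simp [dotProduct_add, dotProduct_smul, he, hw]) (h1.trans (by ring))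
    simp [dotProduct_add, dotProduct_smul, hw', he'] at h4
  refine false_of_double_line (W := hyperplane t ⊓ hyperplane t') (fun h => ht 0 (by simp [h]))
    hF4 hF hFg (finrank_inf_hyperplane t (finrank_hyperplane t')) (fun x hx => hx.1)
    (fun x hx => (hW x hx.1 hx.2).1) ?_
  intro x hx y hy
  have hx1 := mem_hyperplane.1 hx.1
  have hx2 := mem_hyperplane.1 hx.2
  obtain ⟨c, z, hyz, hz, hz'⟩ : ∃ (c : k) (z : Fin 4 → k), y = z + c • e ∧ t ⬝ᵥ z = 0 ∧
      t' ⬝ᵥ z = 0 := by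
    refine ⟨t' ⬝ᵥ y / t' ⬝ᵥ e, y - (t' ⬝ᵥ y / t' ⬝ᵥ e) • e, by simp, ?_, ?_⟩
    · simp [dotProduct_sub, dotProduct_smul, hy, he]
    · simp [dotProduct_sub, dotProduct_smul, he']
  rw [hyz, dirDeriv_add_smul, (hW x hx1 hx2).2]
  have := hg.polar x z
  rw [(hW x hx1 hx2).1, (hW z hz hz').1, (hW (x + z) (by rw [dotProduct_add, hx1, hz, add_zero])
    (by rw [dotProduct_add, hx2, hz', add_zero])).1] at this
  linear_combination -this

/-- A conic with a singular point contains a line through that point. -/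
lemma exists_line_of_singular (hg : IsQuadratic g) {x : Fin 4 → k} (hx : x ≠ 0)
    (htx : t ⬝ᵥ x = 0) (hgx : eval x g = 0) (hd : ∀ y, t ⬝ᵥ y = 0 → dirDeriv g x y = 0) :
    ∃ W : Submodule k (Fin 4 → k), Module.finrank k W = 2 ∧ ∀ y ∈ W, t ⬝ᵥ y = 0 ∧ eval y g = 0 := by
  -- The conic is a cone with vertex `x`, so any zero of `g` in the plane and in a complement of `x`
  -- spans a line with `x`.
  obtain ⟨V, hV⟩ := Submodule.exists_isCompl (k ∙ x)
  have hV3 : Module.finrank k V = 3 := by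
    have h1 := Submodule.finrank_add_eq_of_isCompl hV
    rw [finrank_span_singleton hx] at h1
    simp only [Module.finrank_fintype_fun_eq_card, Fintype.card_fin] at h1
    omega
  obtain ⟨y, hyV, hy0, hgy⟩ :=
    exists_zero_mem hg.hom two_ne_zero (finrank_inf_hyperplane t hV3.ge)
  have hty := mem_hyperplane.1 hyV.1
  have hli : LinearIndependent k ![x, y] := by
    rw [LinearIndependent.pair_iff]
    intro a b hab
    have h1 : b • y ∈ (k ∙ x) ⊓ V := by
      refine ⟨Submodule.mem_span_singleton.2 ⟨-a, ?_⟩, V.smul_mem _ hyV.2⟩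
      rw [neg_smul, neg_eq_iff_add_eq_zero, hab]
    rw [hV.inf_eq_bot, Submodule.mem_bot, smul_eq_zero] at h1
    have hb : b = 0 := h1.resolve_right hy0
    rw [hb, zero_smul, add_zero, smul_eq_zero] at hab
    exact ⟨hab.resolve_right hx, hb⟩
  refine ⟨Submodule.span k (Set.range ![x, y]), ?_, ?_⟩
  · rw [finrank_span_eq_card hli, Fintype.card_fin]
  · intro z hz
    rw [Matrix.range_cons, Matrix.range_cons, Matrix.range_empty, Set.union_empty,
      Set.singleton_union, Submodule.mem_span_pair] at hz
    obtain ⟨a, b, rfl⟩ := hz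
    refine ⟨by simp [dotProduct_add, dotProduct_smul, htx, hty], ?_⟩
    have h1 := hg.polar (b • y) (a • x)
    have h2 : dirDeriv g x (0 + b • y) = 0 := by
      rw [dirDeriv_add_smul, hd y hty, hd 0 (by simp)]
      simp
    have h3 := hg.polar (a • x) (b • y)
    have h4 : dirDeriv g (a • x) (b • y) = a * dirDeriv g x (0 + b • y) := by
      simp only [dirDeriv, Finset.mul_sum, zero_add]
      refine Finset.sum_congr rfl fun j _ => ?_
      rw [eval_smul_of_isHomogeneous (hg.hom.pderiv (i := j))]
      ring
    rw [h3, h4, h2, eval_smul_of_isHomogeneous hg.hom, eval_smul_of_isHomogeneous hg.hom, hgx, hgy]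
    ring

end Conic

/-! ### The conic of tangency along a trope, rationally in the node. -/

/-- The coefficients, up to a scalar, of the diagonal quadric through the six nodes on the plane dual
to the node `t`. -/
def coefNum (t : Fin 4 → k) : Fin 4 → k :=
  let w₀ := (t 0 ^ 2 + t 1 ^ 2 + t 2 ^ 2 + t 3 ^ 2)⁻¹
  let w₁ := (t 0 ^ 2 + t 1 ^ 2 - t 2 ^ 2 - t 3 ^ 2)⁻¹
  let w₂ := (t 0 ^ 2 - t 1 ^ 2 + t 2 ^ 2 - t 3 ^ 2)⁻¹
  let w₃ := (t 0 ^ 2 - t 1 ^ 2 - t 2 ^ 2 + t 3 ^ 2)⁻¹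
  ![w₀ + w₁ + w₂ + w₃, w₀ + w₁ - w₂ - w₃, w₀ - w₁ + w₂ - w₃, w₀ - w₁ - w₂ + w₃]

/-- The coefficients of the diagonal quadric through the six nodes on the plane dual to the node `t`,
normalised at the point `(t₁, -t₀, 0, 0)`. -/
def coef (t : Fin 4 → k) (j : Fin 4) : k :=
  coefNum t j / (coefNum t 0 * t 1 ^ 2 + coefNum t 1 * t 0 ^ 2)

/-- The value of `F_v` at the point `(t₁, -t₀, 0, 0)`. -/
def edge (v : Fin 5 → k) (t : Fin 4 → k) : k :=
  v 0 * (t 0 ^ 4 + t 1 ^ 4) + v 2 * (t 0 ^ 2 * t 1 ^ 2)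

/-- The coefficients are rational functions of `t`, without reference to `γ, δ, ε`; this keeps them
in any field that contains the coordinates of the node. -/
lemma coef_map {L : Type*} [Field L] (φ : L →+* k) (t : Fin 4 → L) (j : Fin 4) :
    coef (fun j => φ (t j)) j = φ (coef t j) := by
  have : ∀ j, coefNum (fun j => φ (t j)) j = φ (coefNum t j) := by
    intro j
    fin_cases j <;> simp [coefNum]
  simp [coef, this]

namespace IsParam

variable {v : Fin 5 → k} {t : Fin 4 → k} {c γ δ ε : k}

lemma sq_eq (hc : c ≠ 0) (h : IsParam v (c • t) γ δ ε) :
    t 0 ^ 2 = (γ * δ * ε + γ + δ + ε) / c ^ 2 ∧ t 1 ^ 2 = (γ * δ * ε + γ - δ - ε) / c ^ 2 ∧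
    t 2 ^ 2 = (γ * δ * ε - γ + δ - ε) / c ^ 2 ∧ t 3 ^ 2 = (γ * δ * ε - γ - δ + ε) / c ^ 2 := by
  have h0 := h.sq0
  have h1 := h.sq1
  have h2 := h.sq2
  have h3 := h.sq3
  simp only [Pi.smul_apply, smul_eq_mul, mul_pow] at h0 h1 h2 h3
  have := pow_ne_zero 2 hc
  refine ⟨?_, ?_, ?_, ?_⟩ <;> rw [eq_div_iff this] <;> rw [mul_comm] <;> assumption

lemma sums_eq (hc : c ≠ 0) (h : IsParam v (c • t) γ δ ε) :
    t 0 ^ 2 + t 1 ^ 2 + t 2 ^ 2 + t 3 ^ 2 = 4 * (γ * δ * ε) / c ^ 2 ∧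
    t 0 ^ 2 + t 1 ^ 2 - t 2 ^ 2 - t 3 ^ 2 = 4 * γ / c ^ 2 ∧
    t 0 ^ 2 - t 1 ^ 2 + t 2 ^ 2 - t 3 ^ 2 = 4 * δ / c ^ 2 ∧
    t 0 ^ 2 - t 1 ^ 2 - t 2 ^ 2 + t 3 ^ 2 = 4 * ε / c ^ 2 := by
  obtain ⟨h0, h1, h2, h3⟩ := sq_eq hc h
  refine ⟨?_, ?_, ?_, ?_⟩ <;> rw [h0, h1, h2, h3] <;> ring

lemma sums_ne [CharZero k] (hc : c ≠ 0) (h : IsParam v (c • t) γ δ ε) :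
    t 0 ^ 2 + t 1 ^ 2 + t 2 ^ 2 + t 3 ^ 2 ≠ 0 ∧ t 0 ^ 2 + t 1 ^ 2 - t 2 ^ 2 - t 3 ^ 2 ≠ 0 ∧
    t 0 ^ 2 - t 1 ^ 2 + t 2 ^ 2 - t 3 ^ 2 ≠ 0 ∧ t 0 ^ 2 - t 1 ^ 2 - t 2 ^ 2 + t 3 ^ 2 ≠ 0 := by
  obtain ⟨w0, w1, w2, w3⟩ := h.sums_eq hc
  have n1 := h.neγ
  have n2 := h.neδ
  have n3 := h.neε
  refine ⟨?_, ?_, ?_, ?_⟩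
  · simp [w0, n1, n2, n3, hc]
  · simp [w1, n1, hc]
  · simp [w2, n2, hc]
  · simp [w3, n3, hc]

lemma edge_mul (h : IsParam v (c • t) γ δ ε) :
    edge v t * c ^ 4 * (1 - γ ^ 2) = 4 * v 0 * γ ^ 2 * ((1 - δ ^ 2) * (1 - ε ^ 2)) := by
  have := h.edge_eq
  simp only [Pi.smul_apply, smul_eq_mul, mul_pow] at this
  rw [← this, edge]
  ring

lemma edge_ne [CharZero k] (h : IsParam v (c • t) γ δ ε) : edge v t ≠ 0 := by
  intro h0
  have := h.edge_mul
  rw [h0] at this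
  simp [h.ne0, h.neγ, h.hδ, h.hε] at this

/-- The inverses of `γδε, γ, δ, ε` are proportional to `1, δε, γε, γδ`, so their signed sums are the
coefficients of the quadric in `quartic_eq`. -/
lemma coef_eq [CharZero k] (hc : c ≠ 0) (h : IsParam v (c • t) γ δ ε) :
    coef t = fun j => c ^ 2 / (2 * γ * ((1 - δ ^ 2) * (1 - ε ^ 2))) *
      ![1 + δ * ε + γ * ε + γ * δ, 1 + δ * ε - γ * ε - γ * δ,
        1 - δ * ε + γ * ε - γ * δ, 1 - δ * ε - γ * ε + γ * δ] j := by
  obtain ⟨h0, h1, h2, h3⟩ := sq_eq hc h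
  have n1 := h.neγ
  have n2 := h.neδ
  have n3 := h.neε
  obtain ⟨w0, w1, w2, w3⟩ := h.sums_eq hc
  have hnum : ∀ j, coefNum t j = c ^ 2 / (4 * (γ * δ * ε)) *
      ![1 + δ * ε + γ * ε + γ * δ, 1 + δ * ε - γ * ε - γ * δ,
        1 - δ * ε + γ * ε - γ * δ, 1 - δ * ε - γ * ε + γ * δ] j := by
    intro j
    simp only [coefNum, w0, w1, w2, w3]
    fin_cases j <;> simp only [Fin.zero_eta, Fin.mk_one, Fin.reduceFinMk, Matrix.cons_val] <;>
      field_simp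
  have hden : coefNum t 0 * t 1 ^ 2 + coefNum t 1 * t 0 ^ 2 =
      2 * γ * ((1 - δ ^ 2) * (1 - ε ^ 2)) / (4 * (γ * δ * ε)) := by
    rw [hnum, hnum, h0, h1]
    simp only [Matrix.cons_val]
    field_simp
    ring
  have n4 := h.hδ
  have n5 := h.hε
  ext j
  rw [coef, hden, hnum]
  field_simp

lemma quartic_decomp [CharZero k] (hc : c ≠ 0) (h : IsParam v (c • t) γ δ ε) :
    ∃ l : MvPolynomial (Fin 4) k, l.IsHomogeneous 3 ∧
      quartic v = C (edge v t) * diag (coef t) ^ 2 + l * linearForm t := by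
  have hP := mul_ne_zero (mul_ne_zero h.hγ h.hδ) h.hε
  have hM : 2 * γ * ((1 - δ ^ 2) * (1 - ε ^ 2)) ≠ 0 :=
    mul_ne_zero (mul_ne_zero two_ne_zero h.neγ) (mul_ne_zero h.hδ h.hε)
  have hq := h.quartic_eq
  have hT : linearForm (translate 0 0 (c • t)) = C c * linearForm t := by
    simp [linearForm, translate, sgn, vier, Fin.sum_univ_four]
    ring
  have hl := fun a => linearForm_isHomogeneous (translate a 0 (c • t))
  refine ⟨C (-(v 0 / ((1 - γ ^ 2) * (1 - δ ^ 2) * (1 - ε ^ 2)) * c)) *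
    (linearForm (translate 1 0 (c • t)) * linearForm (translate 2 0 (c • t)) *
      linearForm (translate 3 0 (c • t))), (((hl 1).mul (hl 2)).mul (hl 3)).C_mul _, ?_⟩
  have hdiag : diag (coef t) = C (c ^ 2 / (2 * γ * ((1 - δ ^ 2) * (1 - ε ^ 2)))) *
      (C (1 + δ * ε + γ * ε + γ * δ) * X 0 ^ 2 + C (1 + δ * ε - γ * ε - γ * δ) * X 1 ^ 2 +
        C (1 - δ * ε + γ * ε - γ * δ) * X 2 ^ 2 + C (1 - δ * ε - γ * ε + γ * δ) * X 3 ^ 2) := by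
    rw [h.coef_eq hc]
    simp only [diag, Fin.sum_univ_four, Matrix.cons_val, C_mul]
    ring
  have hedge : edge v t * (c ^ 2 / (2 * γ * ((1 - δ ^ 2) * (1 - ε ^ 2)))) ^ 2 =
      v 0 / ((1 - γ ^ 2) * (1 - δ ^ 2) * (1 - ε ^ 2)) := by
    have e := h.edge_mul
    have n1 := h.hγ
    have n2 := h.hδ
    have n3 := h.hε
    have n4 := h.neγ
    field_simp
    linear_combination e
  rw [hdiag]
  have hCP : (C ((1 - γ ^ 2) * (1 - δ ^ 2) * (1 - ε ^ 2)) : MvPolynomial (Fin 4) k) ≠ 0 :=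
    C_ne_zero.2 hP
  refine mul_left_cancel₀ hCP ?_
  rw [hq, hT, mul_pow, ← mul_assoc (C (edge v t)), ← C_pow, ← C_mul, hedge]
  have hv0 : (C (v 0) : MvPolynomial (Fin 4) k) = C ((1 - γ ^ 2) * (1 - δ ^ 2) * (1 - ε ^ 2)) *
      C (v 0 / ((1 - γ ^ 2) * (1 - δ ^ 2) * (1 - ε ^ 2))) := by
    rw [← C_mul, mul_div_cancel₀ _ hP]
  rw [hv0, C_neg, C_mul (a := v 0 / _)]
  ring

lemma sq_unique [CharZero k] {s s' : Fin 4 → k} {γ' δ' ε' : k} (h : IsParam v s γ δ ε)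
    (h' : IsParam v s' γ' δ' ε') : γ ^ 2 = γ' ^ 2 ∧ δ ^ 2 = δ' ^ 2 ∧ ε ^ 2 = ε' ^ 2 := by
  have key : ∀ {x a b : k}, x * (1 - a ^ 2) = 2 * v 0 * (1 + a ^ 2) → 1 - a ^ 2 ≠ 0 →
      x * (1 - b ^ 2) = 2 * v 0 * (1 + b ^ 2) → a ^ 2 = b ^ 2 := by
    intro x a b ha ha' hb
    refine mul_left_cancel₀ (mul_ne_zero (by norm_num : (4 : k) ≠ 0) h.ne0) ?_
    linear_combination (1 - a ^ 2) * hb - (1 - b ^ 2) * ha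
  exact ⟨key h.eq2 h.hγ h'.eq2, key h.eq3 h.hδ h'.eq3, key h.eq4 h.hε h'.eq4⟩

end IsParam

lemma smul_translate (a b : Fin 4) (c : k) (t : Fin 4 → k) :
    c • translate a b t = translate a b (c • t) := by
  ext j
  simp only [translate, Pi.smul_apply, smul_eq_mul]
  ring

namespace IsParam

variable {v : Fin 5 → k} {t : Fin 4 → k} {c γ δ ε : k}

lemma exists_translate_smul (h : IsParam v (c • t) γ δ ε) (a b : Fin 4) :
    ∃ γ' δ' ε', IsParam v (c • translate a b t) γ' δ' ε' := by
  rw [smul_translate]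
  exact h.exists_translate a b

/-- By `edge_mul` this value depends only on `c`, `v` and `γ², δ², ε²`, and `v` determines these
squares. Hence one square root `ρ` serves all sixteen planes. -/
lemma edge_translate [CharZero k] (hc : c ≠ 0) (h : IsParam v (c • t) γ δ ε) (a b : Fin 4) :
    edge v (translate a b t) = edge v t := by
  obtain ⟨γ', δ', ε', h'⟩ := h.exists_translate_smul a b
  obtain ⟨e1, e2, e3⟩ := h.sq_unique h'
  have k1 := h.edge_mul
  have k2 := h'.edge_mul
  rw [← e1, ← e2, ← e3, ← k1] at k2
  exact mul_right_cancel₀ (pow_ne_zero 4 hc) (mul_right_cancel₀ h.hγ k2)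

/-- A pencil of lines that separates `Q_i` from the diagonal quadric. -/
lemma exists_separating_line [CharZero k] (hc : c ≠ 0) (h : IsParam v (c • t) γ δ ε) (i : Fin 10) :
    ∃ e f : Fin 4 → k, t ⬝ᵥ e = 0 ∧ t ⬝ᵥ f = 0 ∧ ∃ m ≠ 0, ∀ a b : k,
      eval (a • e + b • f) (diag (coef t)) = m * (a ^ 2 - b ^ 2) ∧
      (a ^ 2 = b ^ 2 → eval (a • e + b • f) (nodeQuadric k i) = 0 → a = 0) := by
  obtain ⟨h0, h1, h2, h3⟩ := sq_eq hc h
  have n1 := h.neγ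
  have n2 := h.neδ
  have n3 := h.neε
  have m1 := h.hγ
  have m2 := h.hδ
  have m3 := h.hε
  obtain ⟨w0, w1, w2, w3⟩ := h.sums_ne hc
  have p1 : t 0 ^ 2 * t 1 ^ 2 - t 2 ^ 2 * t 3 ^ 2 ≠ 0 := by
    have : t 0 ^ 2 * t 1 ^ 2 - t 2 ^ 2 * t 3 ^ 2 = -4 * (δ * ε * (1 - γ ^ 2)) / c ^ 4 := by
      rw [h0, h1, h2, h3]; field_simp; ring
    simp [this, n2, n3, m1, hc]
  have p2 : t 0 ^ 2 * t 2 ^ 2 - t 1 ^ 2 * t 3 ^ 2 ≠ 0 := by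
    have : t 0 ^ 2 * t 2 ^ 2 - t 1 ^ 2 * t 3 ^ 2 = -4 * (γ * ε * (1 - δ ^ 2)) / c ^ 4 := by
      rw [h0, h1, h2, h3]; field_simp; ring
    simp [this, n1, n3, m2, hc]
  have p3 : t 0 ^ 2 * t 3 ^ 2 - t 1 ^ 2 * t 2 ^ 2 ≠ 0 := by
    have : t 0 ^ 2 * t 3 ^ 2 - t 1 ^ 2 * t 2 ^ 2 = -4 * (γ * δ * (1 - ε ^ 2)) / c ^ 4 := by
      rw [h0, h1, h2, h3]; field_simp; ring
    simp [this, n1, n2, m3, hc]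
  have line1 : ∃ m ≠ 0, ∀ a b : k, eval (a • ![t 1, -t 0, 0, 0] + b • ![0, 0, t 3, -t 2])
      (diag (coef t)) = m * (a ^ 2 - b ^ 2) := by
    refine ⟨1, one_ne_zero, fun a b => ?_⟩
    rw [h.coef_eq hc]
    simp [diag, Fin.sum_univ_four, mul_pow, h0, h1, h2, h3]
    field_simp
    ring
  have line2 : ∃ m ≠ 0, ∀ a b : k, eval (a • ![t 2, 0, -t 0, 0] + b • ![0, t 3, 0, -t 1])
      (diag (coef t)) = m * (a ^ 2 - b ^ 2) := by
    refine ⟨δ * (1 - γ ^ 2) / (γ * (1 - δ ^ 2)), by simp [n1, n2, m1, m2], fun a b => ?_⟩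
    rw [h.coef_eq hc]
    simp [diag, Fin.sum_univ_four, mul_pow, h0, h1, h2, h3]
    field_simp
    ring
  have line3 : ∃ m ≠ 0, ∀ a b : k, eval (a • ![t 3, 0, 0, -t 0] + b • ![0, t 2, -t 1, 0])
      (diag (coef t)) = m * (a ^ 2 - b ^ 2) := by
    refine ⟨ε * (1 - γ ^ 2) / (γ * (1 - ε ^ 2)), by simp [n1, n3, m1, m3], fun a b => ?_⟩
    rw [h.coef_eq hc]
    simp [diag, Fin.sum_univ_four, mul_pow, h0, h1, h2, h3]
    field_simp
    ring
  have sq0 : ∀ {a y : k}, y ≠ 0 → a ^ 2 * y = 0 → a = 0 := by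
    intro a y hy hay
    simpa [hy] using hay
  obtain ⟨μ₁, hμ₁, l1⟩ := line1
  obtain ⟨μ₂, hμ₂, l2⟩ := line2
  obtain ⟨μ₃, hμ₃, l3⟩ := line3
  -- The line is chosen according to the way `Q_i` pairs the coordinates, so that `Q_i` restricts to
  -- a combination of `a²` and `b²` without the term `ab`.
  by_cases hi : i = 6 ∨ i = 7
  · refine ⟨_, _, ?_, ?_, μ₂, hμ₂, fun a b => ⟨l2 a b, fun hab => ?_⟩⟩
    · simp [dotProduct, Fin.sum_univ_four]; ring
    · simp [dotProduct, Fin.sum_univ_four]; ring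
    rcases hi with rfl | rfl <;> simp [nodeQuadric] <;> intro e
    · exact sq0 p2 (by linear_combination -(t 0 * t 2 + t 1 * t 3) * e -
        (t 0 * t 2 + t 1 * t 3) * (t 1 * t 3) * hab)
    · exact sq0 p2 (by linear_combination -(t 0 * t 2 - t 1 * t 3) * e +
        (t 0 * t 2 - t 1 * t 3) * (t 1 * t 3) * hab)
  by_cases hi' : i = 8 ∨ i = 9
  · refine ⟨_, _, ?_, ?_, μ₃, hμ₃, fun a b => ⟨l3 a b, fun hab => ?_⟩⟩
    · simp [dotProduct, Fin.sum_univ_four]; ring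
    · simp [dotProduct, Fin.sum_univ_four]; ring
    rcases hi' with rfl | rfl <;> simp [nodeQuadric] <;> intro e
    · exact sq0 p3 (by linear_combination -(t 0 * t 3 + t 1 * t 2) * e -
        (t 0 * t 3 + t 1 * t 2) * (t 1 * t 2) * hab)
    · exact sq0 p3 (by linear_combination -(t 0 * t 3 - t 1 * t 2) * e +
        (t 0 * t 3 - t 1 * t 2) * (t 1 * t 2) * hab)
  refine ⟨_, _, ?_, ?_, μ₁, hμ₁, fun a b => ⟨l1 a b, fun hab => ?_⟩⟩
  · simp [dotProduct, Fin.sum_univ_four]; ring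
  · simp [dotProduct, Fin.sum_univ_four]; ring
  fin_cases i <;> simp [nodeQuadric] at hi hi' ⊢ <;> intro e
  · exact sq0 w3 (by linear_combination -e - (t 2 ^ 2 - t 3 ^ 2) * hab)
  · exact sq0 w2 (by linear_combination -e + (t 2 ^ 2 - t 3 ^ 2) * hab)
  · exact sq0 w1 (by linear_combination e - (t 2 ^ 2 + t 3 ^ 2) * hab)
  · exact sq0 w0 (by linear_combination e + (t 2 ^ 2 + t 3 ^ 2) * hab)
  · exact sq0 p1 (by linear_combination -(t 0 * t 1 + t 2 * t 3) * e -
      (t 0 * t 1 + t 2 * t 3) * (t 2 * t 3) * hab)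
  · exact sq0 p1 (by linear_combination -(t 0 * t 1 - t 2 * t 3) * e +
      (t 0 * t 1 - t 2 * t 3) * (t 2 * t 3) * hab)

end IsParam

/-! ### The candidate conics and the distinctness of the sixteen planes. -/

lemma linearForm_ne_zero {t : Fin 4 → k} (ht : t ≠ 0) : linearForm t ≠ 0 := by
  obtain ⟨j, hj⟩ := Function.ne_iff.1 ht
  intro h
  have := eval_linearForm t (Pi.single j 1)
  rw [h] at this
  simp at this
  exact hj this.symm

lemma linearForm_prime {t : Fin 4 → k} (ht : t ≠ 0) : Prime (linearForm t) := by
  have h0 := linearForm_ne_zero ht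
  refine (irreducible_of_totalDegree_eq_one ((linearForm_isHomogeneous t).totalDegree h0) ?_).prime
  intro x hx
  obtain ⟨d, hd⟩ := ne_zero_iff.1 h0
  refine isUnit_iff_ne_zero.2 ?_
  rintro rfl
  exact hd (zero_dvd_iff.1 (hx d))

lemma linearForm_smul (c : k) (t : Fin 4 → k) : linearForm (c • t) = C c * linearForm t := by
  simp [linearForm, Finset.mul_sum, mul_assoc]

/-- The quadric that cuts out an associated conic on the plane dual to `t`. -/
noncomputable def conicForm {R : Type*} [Field R] (i : Fin 10) (t : Fin 4 → R) (ρ : R) :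
    MvPolynomial (Fin 4) R :=
  nodeQuadric R i + C ρ * diag (coef t)

/-- An associated conic. -/
noncomputable def conic (i : Fin 10) (t : Fin 4 → k) (ρ : k) : Set (ℙ k (Fin 4 → k)) :=
  zeroLocus {linearForm t, conicForm i t ρ}

lemma conicForm_isQuadratic (i : Fin 10) (t : Fin 4 → k) (ρ : k) :
    IsQuadratic (conicForm i t ρ) :=
  (nodeQuadric_isQuadratic i).add ((diag_isQuadratic _).C_mul ρ)

lemma eval_conicForm (i : Fin 10) (t : Fin 4 → k) (ρ : k) (x : Fin 4 → k) :
    eval x (conicForm i t ρ) = eval x (nodeQuadric k i) + ρ * eval x (diag (coef t)) := by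
  simp [conicForm]

lemma mem_zeroLocus_pair {f g : MvPolynomial (Fin 4) k} {m n : ℕ} (hf : f.IsHomogeneous m)
    (hg : g.IsHomogeneous n) (x : Fin 4 → k) (hx : x ≠ 0) :
    .mk k x hx ∈ zeroLocus {f, g} ↔ eval x f = 0 ∧ eval x g = 0 := by
  rw [mem_zeroLocus_iff]
  · simp
  · rintro q (rfl | rfl)
    · exact ⟨_, hf⟩
    · exact ⟨_, hg⟩

lemma mem_conic (i : Fin 10) (t : Fin 4 → k) (ρ : k) (x : Fin 4 → k) (hx : x ≠ 0) :
    .mk k x hx ∈ conic i t ρ ↔ t ⬝ᵥ x = 0 ∧ eval x (conicForm i t ρ) = 0 := by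
  rw [conic, mem_zeroLocus_pair (linearForm_isHomogeneous t) (conicForm_isQuadratic i t ρ).hom,
    eval_linearForm]

lemma sgn_injective {a a' : Fin 4} (h : ∀ j, sgn a' j = sgn a j) : a = a' := by
  revert a a'
  decide

lemma sgn_zero (a : Fin 4) : sgn a 0 = 1 := by
  revert a
  decide

lemma translate_sq (a b : Fin 4) (t : Fin 4 → k) (j : Fin 4) :
    translate a b t j ^ 2 = t (vier b j) ^ 2 := by
  have : (sgn a j) ^ 2 = 1 := by
    revert a j
    decide
  rw [translate, mul_pow, ← Int.cast_pow, this, Int.cast_one, one_mul]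

/-- Different Heisenberg translates of a node are different points. -/
lemma IsParam.translate_injective [CharZero k] {v : Fin 5 → k} {t : Fin 4 → k} {c γ δ ε : k}
    (hc : c ≠ 0) (h : IsParam v (c • t) γ δ ε) {a b a' b' : Fin 4} {d : k}
    (hd : translate a' b' t = d • translate a b t) : a = a' ∧ b = b' := by
  obtain ⟨w0, w1, w2, -⟩ := h.sums_ne hc
  have hsq : ∀ j, t (vier b' j) ^ 2 = d ^ 2 * t (vier b j) ^ 2 := by
    intro j
    rw [← translate_sq a', hd, ← translate_sq a b t, Pi.smul_apply, smul_eq_mul, mul_pow]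
  have hsum : ∀ b, t (vier b 0) ^ 2 + t (vier b 1) ^ 2 + t (vier b 2) ^ 2 + t (vier b 3) ^ 2 =
      t 0 ^ 2 + t 1 ^ 2 + t 2 ^ 2 + t 3 ^ 2 := by
    intro b
    fin_cases b <;> simp [vier] <;> ring
  have hd2 : d ^ 2 = 1 := by
    refine mul_right_cancel₀ w0 ?_
    rw [one_mul]
    nth_rewrite 1 [← hsum b]
    rw [← hsum b', hsq, hsq, hsq, hsq]
    ring
  simp only [hd2, one_mul] at hsq
  -- Two different double transpositions would identify the squared coordinates in pairs, and one of
  -- the nonzero signed sums would vanish.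
  have hb : b = b' := by
    by_contra hb
    have e0 := hsq 0
    have e1 := hsq 1
    have e2 := hsq 2
    have hor : t 0 ^ 2 + t 1 ^ 2 - t 2 ^ 2 - t 3 ^ 2 = 0 ∨
        t 0 ^ 2 - t 1 ^ 2 + t 2 ^ 2 - t 3 ^ 2 = 0 := by
      fin_cases b <;> fin_cases b' <;> first | exact absurd rfl hb | skip
      all_goals
        simp only [vier, Fin.zero_eta, Fin.mk_one, Fin.reduceFinMk, Matrix.cons_val] at e0 e1 e2
        first
        | (left; linear_combination -e0 - e1)
        | (left; linear_combination e0 + e1)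
        | (right; linear_combination -e0 - e2)
        | (right; linear_combination e0 + e2)
    rcases hor with h | h
    · exact w1 h
    · exact w2 h
  subst hb
  have ht : ∀ j, t j ≠ 0 := by
    intro j hj
    have := h.ne_zero j
    simp [hj] at this
  have hs : ∀ j, (sgn a' j : k) = d * sgn a j := by
    intro j
    refine mul_right_cancel₀ (ht (vier b j)) ?_
    have := congrFun hd j
    simp only [translate, Pi.smul_apply, smul_eq_mul] at this
    rw [this, mul_assoc]
  have hd1 : d = 1 := by
    have := hs 0
    rw [sgn_zero, sgn_zero] at this
    simpa using this.symm
  refine ⟨sgn_injective fun j => ?_, rfl⟩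
  have := hs j
  rw [hd1, one_mul] at this
  exact_mod_cast this

lemma IsQuadratic.eval_zero {f : MvPolynomial (Fin 4) k} (hf : IsQuadratic f) :
    eval 0 f = 0 := by
  have := eval_smul_of_isHomogeneous hf.hom 0 0
  rw [zero_smul] at this
  rw [this]
  ring

lemma quartic_injective [CharZero k] : Function.Injective (quartic (R := k)) := by
  intro p q h
  have key := fun s => congrArg (eval s) h
  simp only [eval_quartic] at key
  have e0 := key ![1, 0, 0, 0]
  have e2 := key ![1, 1, 0, 0]
  have e3 := key ![1, 0, 1, 0]
  have e4 := key ![1, 0, 0, 1]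
  have e1 := key ![1, 1, 1, 1]
  simp at e0 e1 e2 e3 e4
  ext j
  fin_cases j <;> simp only [Fin.zero_eta, Fin.mk_one, Fin.reduceFinMk]
  · exact e0
  · linear_combination e1 - 2 * e2 - 2 * e3 - 2 * e4 + 8 * e0
  · linear_combination e2 - 2 * e0
  · linear_combination e3 - 2 * e0
  · linear_combination e4 - 2 * e0

lemma exists_node_ne_zero [CharZero k] (i : Fin 10) : ∃ j, node k i j ≠ 0 := by
  by_contra! h
  have h0 := h 0
  have h2 := h 2
  have h3 := h 3
  have h4 := h 4
  fin_cases i <;> simp [node] at h0 h2 h3 h4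

/-! ### The associated conics: count, smoothness and field of definition. -/

/-- A smooth quartic `F_p = α Q_i² + α' F_v` and a node `t` of `F_v = 0`, with the square root `ρ`
that enters the equations `Q_i ± ρ ∑ nⱼ xⱼ² = 0` of the two conics in the plane dual to `t`. -/
structure ConicData (i : Fin 10) (p v : Fin 5 → k) (t : Fin 4 → k) (c ρ α α' : k) : Prop where
  smooth : ∀ s ≠ 0, ∃ j, grad p s j ≠ 0
  indep : v ∉ Submodule.span k {node k i}
  c_ne : c ≠ 0
  α_ne : α ≠ 0
  α'_ne : α' ≠ 0
  param : ∃ γ δ ε, IsParam v (c • t) γ δ ε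
  pencil : ∀ j, p j = α * node k i j + α' * v j
  sq : α * ρ ^ 2 = -(α' * edge v t)

namespace ConicData

variable {i : Fin 10} {p v : Fin 5 → k} {t : Fin 4 → k} {c ρ α α' : k}

lemma translate [CharZero k] (h : ConicData i p v t c ρ α α') (a b : Fin 4) (s : Bool) :
    ConicData i p v (translate a b t) c (cond s ρ (-ρ)) α α' := by
  obtain ⟨h1, h2, h3, h4, h5, ⟨γ, δ, ε, h6⟩, h7, h8⟩ := h
  refine ⟨h1, h2, h3, h4, h5, h6.exists_translate_smul a b, h7, ?_⟩
  rw [h6.edge_translate h3, ← h8]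
  cases s <;> simp

lemma ne_zero [CharZero k] (h : ConicData i p v t c ρ α α') (j : Fin 4) : t j ≠ 0 := by
  obtain ⟨γ, δ, ε, h6⟩ := h.param
  intro hj
  have := h6.ne_zero j
  simp [hj] at this

lemma vec_ne_zero [CharZero k] (h : ConicData i p v t c ρ α α') : t ≠ 0 :=
  fun h0 => h.ne_zero 0 (by simp [h0])

lemma ρ_ne [CharZero k] (h : ConicData i p v t c ρ α α') : ρ ≠ 0 := by
  obtain ⟨γ, δ, ε, h6⟩ := h.param
  rintro rfl
  have := h.sq
  simp [h.α'_ne, h6.edge_ne] at this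

lemma quartic_pencil (h : ConicData i p v t c ρ α α') :
    quartic p = C α * nodeQuadric k i ^ 2 + C α' * quartic v := by
  rw [← quartic_node]
  simp only [quartic, h.pencil, C_add, C_mul]
  ring

/-- On the plane both `Q_i` and the diagonal quadric enter `F_p` through their squares, and the
choice of `ρ` makes this a difference of squares. -/
lemma quartic_factor [CharZero k] (h : ConicData i p v t c ρ α α') :
    ∃ l, quartic p = C α * (conicForm i t ρ * conicForm i t (-ρ)) + l * linearForm t := by
  obtain ⟨γ, δ, ε, h6⟩ := h.param
  obtain ⟨l, -, hl⟩ := h6.quartic_decomp h.c_ne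
  refine ⟨C α' * l, ?_⟩
  have := congrArg (C (σ := Fin 4)) h.sq
  simp only [C_mul, C_neg, C_pow] at this
  rw [h.quartic_pencil, hl, conicForm, conicForm, C_neg]
  linear_combination diag (coef t) ^ 2 * this

lemma smooth_quartic (h : ConicData i p v t c ρ α α') (s : Fin 4 → k) (hs : s ≠ 0) :
    ∃ j, eval s (pderiv j (quartic p)) ≠ 0 := by
  simpa only [eval_pderiv_quartic] using h.smooth s hs

lemma conic_subset [CharZero k] (h : ConicData i p v t c ρ α α') :
    conic i t ρ ⊆ zeroLocus {quartic p} := by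
  intro x
  induction x using Projectivization.ind with
  | h x hx =>
    rw [mem_conic, mem_zeroLocus_iff (by rintro _ rfl; exact ⟨4, quartic_isHomogeneous p⟩)]
    rintro ⟨h1, h2⟩ _ rfl
    obtain ⟨l, hl⟩ := h.quartic_factor
    rw [hl]
    simp [h2, eval_linearForm, h1]

/-- The vectors `q_i` and `v` are independent, so the scalars `α, α'` in the definition of an
associated conic are not a choice. -/
lemma coeff_unique [CharZero k] (h : ConicData i p v t c ρ α α') {x y : k}
    (hxy : quartic p = C x * nodeQuadric k i ^ 2 + C y * quartic v) : x = α ∧ y = α' := by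
  have hq : quartic p = quartic fun j => x * node k i j + y * v j := by
    rw [hxy, ← quartic_node]
    simp only [quartic, C_add, C_mul]
    ring
  have hj : ∀ j, (y - α') * v j = (α - x) * node k i j := by
    intro j
    linear_combination h.pencil j - congrFun (quartic_injective hq) j
  have hy : y = α' := by
    by_contra hy
    refine h.indep (Submodule.mem_span_singleton.2 ⟨(α - x) / (y - α'), funext fun j => ?_⟩)
    rw [Pi.smul_apply, smul_eq_mul]
    have := sub_ne_zero.2 hy
    field_simp
    linear_combination -hj j
  refine ⟨?_, hy⟩
  obtain ⟨j, hn⟩ := exists_node_ne_zero (k := k) i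
  have := hj j
  rw [hy, sub_self, zero_mul] at this
  exact (sub_eq_zero.1 ((mul_eq_zero.1 this.symm).resolve_right hn)).symm

variable [IsAlgClosed k]

lemma exists_eq_smul_of_conic_eq [CharZero k] {t' : Fin 4 → k} {ρ' : k}
    (h : ConicData i p v t c ρ α α') (he : conic i t ρ = conic i t' ρ') : ∃ d : k, t' = d • t := by
  obtain ⟨l, hl⟩ := h.quartic_factor
  refine exists_eq_smul_of_subset h.ne_zero (quartic_isHomogeneous p) h.smooth_quartic hl
    (conicForm_isQuadratic i t ρ) fun x hx h1 h2 => ?_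
  have := (mem_conic i t ρ x hx).2 ⟨h1, h2⟩
  rw [he, mem_conic] at this
  exact this.1

/-- A common point of both conics is a zero of `Q_i` and of the diagonal quadric, and on the
separating line there is none. -/
lemma conic_ne_conic_neg [CharZero k] (h : ConicData i p v t c ρ α α') :
    conic i t ρ ≠ conic i t (-ρ) := by
  intro he
  obtain ⟨γ, δ, ε, h6⟩ := h.param
  obtain ⟨e, f, h1, h2, m, hm, hs⟩ := h6.exists_separating_line h.c_ne i
  obtain ⟨a, b, hab, h0⟩ :=
    exists_zero_of_isHomogeneous (conicForm_isQuadratic i t ρ).hom two_ne_zero e f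
  obtain ⟨e1, e2⟩ := hs a b
  have sep : a ^ 2 - b ^ 2 = 0 → eval (a • e + b • f) (nodeQuadric k i) = 0 → False := by
    intro g1 g2
    have g3 := e2 (sub_eq_zero.1 g1) g2
    subst g3
    have : b = 0 := by simpa using g1
    simp [this] at hab
  -- The vectors `e, f` are not known to be independent, but `sep` also excludes the zero vector.
  by_cases hx : a • e + b • f = 0
  · rw [hx] at e1 e2 sep
    refine sep ?_ (nodeQuadric_isQuadratic i).eval_zero
    rw [(diag_isQuadratic (coef t)).eval_zero] at e1
    exact (mul_eq_zero.1 e1.symm).resolve_left hm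
  · have := (mem_conic i t ρ _ hx).2 ⟨by simp [dotProduct_add, dotProduct_smul, h1, h2], h0⟩
    rw [he, mem_conic] at this
    have h3 := this.2
    rw [eval_conicForm, e1] at h0 h3
    have g1 : 2 * (ρ * m) * (a ^ 2 - b ^ 2) = 0 := by linear_combination h0 - h3
    have g2 : a ^ 2 - b ^ 2 = 0 :=
      (mul_eq_zero.1 g1).resolve_left (mul_ne_zero two_ne_zero (mul_ne_zero h.ρ_ne hm))
    exact sep g2 (by linear_combination h0 - ρ * m * g2)

/-- The `32` conics are different. -/
lemma conic_injective [CharZero k] (h : ConicData i p v t c ρ α α') :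
    Function.Injective fun x : Fin 4 × Fin 4 × Bool =>
      conic i (HeisenbergQuartic.translate x.1 x.2.1 t) (cond x.2.2 ρ (-ρ)) := by
  rintro ⟨a, b, s⟩ ⟨a', b', s'⟩ he
  simp only at he
  obtain ⟨γ, δ, ε, h6⟩ := h.param
  obtain ⟨d, hd⟩ := (h.translate a b s).exists_eq_smul_of_conic_eq he
  obtain ⟨rfl, rfl⟩ := h6.translate_injective h.c_ne hd
  have hne := (h.translate a b true).conic_ne_conic_neg
  cases s <;> cases s'
  · rfl
  · exact absurd he.symm hne
  · exact absurd he hne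
  · rfl

/-- A conic with a singular point yields a line on the quartic. -/
lemma not_singular [CharZero k] (h : ConicData i p v t c ρ α α')
    (hline : ¬ ContainsLine (quartic p)) {x : Fin 4 → k} (hx : x ≠ 0)
    (htx : t ⬝ᵥ x = 0) (hgx : eval x (conicForm i t ρ) = 0) :
    LinearIndependent k ![fun j => eval x (pderiv j (linearForm t)),
      fun j => eval x (pderiv j (conicForm i t ρ))] := by
  simp only [pderiv_linearForm, eval_C]
  rw [LinearIndependent.pair_iff]
  intro a b hab
  have hb : b = 0 := by
    by_contra hb
    obtain ⟨W, hW, hWx⟩ := exists_line_of_singular (conicForm_isQuadratic i t ρ) hx htx hgx (by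
      intro y hy
      refine (mul_eq_zero.1 ?_).resolve_left hb
      calc b * dirDeriv (conicForm i t ρ) x y
          = ∑ j, y j * (a * t j + b * eval x (pderiv j (conicForm i t ρ))) - a * (t ⬝ᵥ y) := by
            simp only [dirDeriv, dotProduct, Fin.sum_univ_four]
            ring
        _ = 0 := by
            have := fun j => congrFun hab j
            simp only [Pi.add_apply, Pi.smul_apply, smul_eq_mul, Pi.zero_apply] at this
            simp [this, hy])
    refine hline ⟨W, hW, fun y hy => h.conic_subset ?_⟩
    induction y using Projectivization.ind with
    | h y hy0 =>
      rw [mem_conic]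
      refine hWx y (hy ?_)
      rw [Projectivization.submodule_mk]
      exact Submodule.mem_span_singleton_self y
  refine ⟨?_, hb⟩
  have := congrFun hab 0
  simpa [hb, h.ne_zero 0] using this

lemma not_dvd [CharZero k] (h : ConicData i p v t c ρ α α') :
    ¬ linearForm t ∣ conicForm i t ρ := by
  rintro ⟨m, hm⟩
  obtain ⟨l, hl⟩ := h.quartic_factor
  obtain ⟨x, hx, hx'⟩ := exists_eval_ne_zero h.vec_ne_zero (quartic_isHomogeneous p)
    h.smooth_quartic hl (conicForm_isQuadratic i t ρ)
  apply hx'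
  rw [hm, map_mul, eval_linearForm, hx, zero_mul]

lemma isAssociatedConic_conic [CharZero k] (h : ConicData i p v t c ρ α α') :
    IsAssociatedConic i p v (conic i t ρ) := by
  obtain ⟨γ, δ, ε, h6⟩ := h.param
  obtain ⟨l, hl3, hl⟩ := h6.quartic_decomp h.c_ne
  obtain ⟨a, ha⟩ := IsAlgClosed.exists_pow_nat_eq α two_pos
  have ha0 : a ≠ 0 := by
    rintro rfl
    exact h.α_ne (by simpa using ha.symm)
  refine ⟨t, h.vec_ne_zero, ?_, α, α', edge v t, a, a * ρ, diag (coef t), l,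
    (diag_isQuadratic _).hom, hl3, h.quartic_pencil, hl, ha, ?_, ?_⟩
  · rw [isSingularPoint_quartic_iff]
    intro j
    have h7 := h6.grad_eq_zero j
    have h8 := eval_smul_of_isHomogeneous ((quartic_isHomogeneous v).pderiv (i := j)) c t
    rw [eval_pderiv_quartic, eval_pderiv_quartic, h7] at h8
    exact (mul_eq_zero.1 h8.symm).resolve_left (pow_ne_zero _ h.c_ne)
  · rw [mul_pow, ha, h.sq]
    ring
  · ext x
    induction x using Projectivization.ind with
    | h x hx =>
      rw [mem_conic, mem_zeroLocus_pair (linearForm_isHomogeneous t)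
        (((nodeQuadric_isHomogeneous i).C_mul a).add ((diag_isQuadratic _).hom.C_mul _)),
        eval_linearForm]
      refine and_congr_right fun _ => ?_
      rw [eval_conicForm]
      have : eval x (C a * nodeQuadric k i + C (a * ρ) * diag (coef t)) =
          a * (eval x (nodeQuadric k i) + ρ * eval x (diag (coef t))) := by
        simp only [map_add, map_mul, eval_C]
        ring
      rw [this, mul_eq_zero, or_iff_right ha0]

end ConicData

namespace ConicData

variable {i : Fin 10} {p v : Fin 5 → k} {t : Fin 4 → k} {c ρ α α' : k}

lemma exists_conic_eq [CharZero k] (h : ConicData i p v t c ρ α α') {Z : Set (ℙ k (Fin 4 → k))}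
    (hZ : IsAssociatedConic i p v Z) :
    ∃ a b s, Z = conic i (HeisenbergQuartic.translate a b t) (cond s ρ (-ρ)) := by
  obtain ⟨s, hs, hsing, x, y, μ, a, b, Q', l, hQ', -, hpq, hv, ha, hb, rfl⟩ := hZ
  rw [isSingularPoint_quartic_iff] at hsing
  obtain ⟨rfl, rfl⟩ := h.coeff_unique hpq
  obtain ⟨γ, δ, ε, h6⟩ := h.param
  obtain ⟨a', b', d, hd, hsd⟩ := h6.exists_translate_of_grad hs hsing
  rw [← smul_translate, smul_smul] at hsd
  have h' := h.translate a' b' true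
  simp only [cond_true] at h'
  have key : ∃ s, ∀ z, HeisenbergQuartic.translate a' b' t ⬝ᵥ z = 0 →
      b * eval z Q' = a * (cond s ρ (-ρ) *
        eval z (diag (coef (HeisenbergQuartic.translate a' b' t)))) := by
    generalize HeisenbergQuartic.translate a' b' t = u at *
    obtain ⟨_, _, _, h7⟩ := h'.param
    obtain ⟨l', -, hl'⟩ := h7.quartic_decomp h.c_ne
    -- Modulo the linear form, both `b² Q'²` and `a² ρ² D²` equal `-α' F_v`, where `D` is the
    -- diagonal quadric. Primality then gives `b Q' = ± a ρ D` on the plane.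
    have hdvd : linearForm u ∣ (C b * Q' - C (a * ρ) * diag (coef u)) *
        (C b * Q' + C (a * ρ) * diag (coef u)) := by
      refine ⟨C (-y) * (l' - l * C (d * c)), ?_⟩
      rw [hsd, linearForm_smul, C_mul] at hv
      have e1 := congrArg (C (σ := Fin 4)) hb
      have e2 := congrArg (C (σ := Fin 4)) h'.sq
      rw [← ha] at e2
      simp only [C_mul, C_neg, C_pow] at e1 e2 ⊢
      linear_combination Q' ^ 2 * e1 - diag (coef u) ^ 2 * e2 - C y * hl' + C y * hv
    rcases (linearForm_prime h'.vec_ne_zero).dvd_or_dvd hdvd with ⟨m, hm⟩ | ⟨m, hm⟩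
    · refine ⟨true, fun z hz => ?_⟩
      have := congrArg (eval z) hm
      simp only [map_sub, map_mul, eval_C, eval_linearForm, hz, zero_mul] at this
      simp only [cond_true]
      linear_combination this
    · refine ⟨false, fun z hz => ?_⟩
      have := congrArg (eval z) hm
      simp only [map_add, map_mul, eval_C, eval_linearForm, hz, zero_mul] at this
      simp only [cond_false]
      linear_combination this
  obtain ⟨s', hs'⟩ := key
  refine ⟨a', b', s', ?_⟩
  have ha0 : a ≠ 0 := by
    rintro rfl
    exact h.α_ne (by simpa using ha.symm)
  have hdc := mul_ne_zero hd h.c_ne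
  ext z
  induction z using Projectivization.ind with
  | h z hz =>
    rw [mem_conic, mem_zeroLocus_pair (linearForm_isHomogeneous s)
      (((nodeQuadric_isHomogeneous i).C_mul a).add (hQ'.C_mul b)), eval_linearForm, hsd,
      smul_dotProduct, smul_eq_mul, mul_eq_zero, or_iff_right hdc]
    refine and_congr_right fun hz' => ?_
    rw [eval_conicForm, map_add, map_mul, map_mul, eval_C, eval_C, hs' z hz', ← mul_add,
      mul_eq_zero, or_iff_right ha0]

variable [IsAlgClosed k]

lemma setOf_isAssociatedConic [CharZero k] (h : ConicData i p v t c ρ α α') :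
    {Z | IsAssociatedConic i p v Z} = Set.range fun x : Fin 4 × Fin 4 × Bool =>
      conic i (HeisenbergQuartic.translate x.1 x.2.1 t) (cond x.2.2 ρ (-ρ)) := by
  ext Z
  constructor
  · intro hZ
    obtain ⟨a, b, s, rfl⟩ := h.exists_conic_eq hZ
    exact ⟨(a, b, s), rfl⟩
  · rintro ⟨⟨a, b, s⟩, rfl⟩
    exact (h.translate a b s).isAssociatedConic_conic

/-- There are `32` associated conics. -/
lemma ncard_isAssociatedConic [CharZero k] (h : ConicData i p v t c ρ α α') :
    {Z | IsAssociatedConic i p v Z}.ncard = 32 := by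
  rw [h.setOf_isAssociatedConic, Set.ncard_range_of_injective h.conic_injective]
  simp

variable {K : Type*} [Field K] [Algebra K k]

/-- An associated conic is defined over every field that contains the node and the square root. -/
lemma isConicEquations [CharZero k] (h : ConicData i p v t c ρ α α') {L : IntermediateField K k}
    {tL : Fin 4 → L} (ht : t = fun j => algebraMap L k (tL j)) {ρL : L}
    (hρ : ρ = algebraMap L k ρL) :
    map (algebraMap L k) (linearForm tL) = linearForm t ∧
    map (algebraMap L k) (conicForm i tL ρL) = conicForm i t ρ ∧
    IsConicEquations L (conic i t ρ) (linearForm tL) (conicForm i tL ρL) := by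
  have e1 : map (algebraMap L k) (linearForm tL) = linearForm t := by
    simp [linearForm, ht]
  have e2 : map (algebraMap L k) (conicForm i tL ρL) = conicForm i t ρ := by
    have hn : map (algebraMap L k) (nodeQuadric L i) = nodeQuadric k i := by
      fin_cases i <;> simp [nodeQuadric]
    have hd : map (algebraMap L k) (diag (coef tL)) = diag (coef t) := by
      simp only [diag, map_sum, map_mul, map_pow, map_X, map_C]
      rw [ht]
      simp only [coef_map]
    rw [conicForm, map_add, map_mul, map_C, hn, hd, ← hρ, conicForm]
  refine ⟨e1, e2, ?_, linearForm_isHomogeneous _, ?_, ?_, ?_⟩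
  · intro h0
    rw [h0, map_zero] at e1
    exact linearForm_ne_zero h.vec_ne_zero e1.symm
  · refine (nodeQuadric_isHomogeneous i).add (IsHomogeneous.C_mul ?_ _)
    exact (diag_isQuadratic _).hom
  · rw [e1, e2]
    exact h.not_dvd
  · rw [e1, e2, conic]

lemma isSmoothConicOver [CharZero k] (h : ConicData i p v t c ρ α α') {L : IntermediateField K k}
    {tL : Fin 4 → L} (ht : t = fun j => algebraMap L k (tL j)) {ρL : L}
    (hρ : ρ = algebraMap L k ρL) (hline : ¬ ContainsLine (quartic p)) :
    IsSmoothConicOver L (conic i t ρ) := by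
  obtain ⟨e1, e2, e3⟩ := h.isConicEquations ht hρ
  refine ⟨_, _, e3, fun x hx => ?_⟩
  rw [e1, e2]
  rw [← x.mk_rep, mem_conic] at hx
  exact h.not_singular hline x.rep_nonzero hx.1 hx.2

end ConicData

/-! ### Assembly over the number field. -/

lemma translate_map {L : Type*} [Field L] (φ : L →+* k) (a b : Fin 4) (t : Fin 4 → L) :
    translate a b (fun j => φ (t j)) = fun j => φ (translate a b t j) := by
  ext j
  simp [translate]

lemma map_node {R S : Type*} [CommRing R] [CommRing S] (φ : R →+* S) (i : Fin 10) (j : Fin 5) :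
    φ (node R i j) = node S i j := by
  fin_cases i <;> fin_cases j <;> simp [node, map_ofNat]

end HeisenbergQuartic

open HeisenbergQuartic

theorem mainTheorem6 (K : Type*) [Field K] [NumberField K] (i : Fin 10) (p v : Fin 5 → K)
    -- `X_p` is smooth, and `p` is not on the Segre cubic
    (p' : Fin 5 → AlgebraicClosure K) (hp' : p' = fun j => algebraMap K (AlgebraicClosure K) (p j))
    (hsmooth : ∀ x, ¬ HeisenbergQuartic.IsSingularPoint (HeisenbergQuartic.quartic p') x)
    (hΔ : HeisenbergQuartic.segre p ≠ 0)
    -- `v = (A_i, B_i, C_i, D_i, E_i)` represents the third point `p_i`, with the coordinates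
    -- scaled such that `β F_p = Δ Q_i² + F_{p_i}` for a scalar `β`
    (hv : HeisenbergQuartic.IsThirdPoint i p v)
    (β : K) (hβ : β • p = HeisenbergQuartic.segre p • HeisenbergQuartic.node K i + v)
    (hB : v 1 ≠ 0)
    (v' : Fin 5 → AlgebraicClosure K) (hv' : v' = fun j => algebraMap K (AlgebraicClosure K) (v j))
    -- the roots; the second polynomial is a genuine quadratic polynomial
    (r₁ r₂ r₃ rμ rμ' : AlgebraicClosure K)
    (hr₁ : (HeisenbergQuartic.firstPoly v').IsRoot r₁)
    (hlead : v' 4 * r₁ ^ 2 - v' 3 ≠ 0)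
    (hr₂ : (HeisenbergQuartic.secondPoly v' r₁).IsRoot r₂)
    (hr₃ : 2 * (v' 2 ^ 2 - 4 * v' 0 ^ 2) * r₃ * r₂ * r₁ + v' 1 * v' 2 * r₁ ^ 2 + v' 0 * v' 1
      + v' 0 * v' 1 * r₁ ^ 4 = 0)
    (hrμ : (HeisenbergQuartic.muPoly (HeisenbergQuartic.segre p') v' r₁).IsRoot rμ)
    (hrμ' : (HeisenbergQuartic.muPoly (HeisenbergQuartic.segre p') v' (r₂ / r₃)).IsRoot rμ') :
    {Z | HeisenbergQuartic.IsAssociatedConic i p' v' Z}.ncard = 32 ∧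
    ∀ Z, HeisenbergQuartic.IsAssociatedConic i p' v' Z →
      Z ⊆ HeisenbergQuartic.zeroLocus {HeisenbergQuartic.quartic p'} ∧
      HeisenbergQuartic.IsConicOver (IntermediateField.adjoin K {r₁, r₂, rμ, rμ'}) Z ∧
      (¬ HeisenbergQuartic.ContainsLine (HeisenbergQuartic.quartic p') →
        HeisenbergQuartic.IsSmoothConicOver
          (IntermediateField.adjoin K {r₁, r₂, rμ, rμ'}) Z) := by
  have hφ : Function.Injective (algebraMap K (AlgebraicClosure K)) :=
    (algebraMap K (AlgebraicClosure K)).injective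
  have hnode : ∀ j, algebraMap K (AlgebraicClosure K) (node K i j) =
      node (AlgebraicClosure K) i j := map_node _ i
  have hseg : ∀ q : Fin 5 → K, segre (fun j => algebraMap K (AlgebraicClosure K) (q j)) =
      algebraMap K (AlgebraicClosure K) (segre q) := fun q => by
    simp [segre, map_ofNat]
  have hβ0 : β ≠ 0 := by
    rintro rfl
    refine hv.ne_node (Submodule.mem_span_singleton.2 ⟨-segre p, ?_⟩)
    rw [zero_smul] at hβ
    rw [neg_smul]
    exact neg_eq_of_add_eq_zero_right hβ.symm
  have hb0 : algebraMap K (AlgebraicClosure K) β ≠ 0 := by simpa using hβ0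
  have hd0 : segre p' ≠ 0 := by
    rw [hp', hseg]
    simpa using hΔ
  have hβ' : ∀ j, algebraMap K (AlgebraicClosure K) β * p' j =
      segre p' * node (AlgebraicClosure K) i j + v' j := by
    intro j
    have := congrArg (algebraMap K (AlgebraicClosure K)) (congrFun hβ j)
    simpa [hp', hv', hseg, hnode] using this
  have hsm : ∀ s ≠ 0, ∃ j, grad p' s j ≠ 0 := by
    intro s hs
    by_contra! h
    exact hsmooth _ ((isSingularPoint_quartic_iff p' s hs).2 h)
  have hv0 : segre v' = 0 := by rw [hv', hseg, hv.mem_segre, map_zero]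
  have hind : v' ∉ Submodule.span (AlgebraicClosure K) {node (AlgebraicClosure K) i} := by
    intro h
    obtain ⟨a, ha⟩ := Submodule.mem_span_singleton.1 h
    obtain ⟨j₀, hj₀⟩ := exists_node_ne_zero (k := K) i
    refine hv.ne_node (Submodule.mem_span_singleton.2 ⟨v j₀ / node K i j₀, funext fun j => ?_⟩)
    rw [Pi.smul_apply, smul_eq_mul, div_mul_eq_mul_div, div_eq_iff hj₀]
    apply hφ
    have e : ∀ j, algebraMap K (AlgebraicClosure K) (v j) =
        a * node (AlgebraicClosure K) i j := by
      intro j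
      have := congrFun ha j
      rw [hv'] at this
      exact this.symm
    rw [map_mul, map_mul, e, e, hnode, hnode]
    ring
  obtain ⟨n0, nx⟩ := thirdPoint_facet hsm hb0 hβ' hv0
  obtain ⟨a2, a3, a4⟩ := nx 1 (by ring)
  obtain ⟨b2, b3, b4⟩ := nx (-1) (by ring)
  have n1 : v' 1 ≠ 0 := by
    rw [hv']
    simpa using hB
  obtain ⟨s, γ, δ, ε, hs⟩ := exists_isParam n0 n1 (fun h => a2 (by linear_combination h))
    (fun h => b2 (by linear_combination -h)) (fun h => a3 (by linear_combination h))
    (fun h => b3 (by linear_combination -h)) (fun h => a4 (by linear_combination h))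
    (fun h => b4 (by linear_combination -h)) hv0
  obtain ⟨c, γ', δ', ε', hc, ht⟩ := hs.exists_coordinates hr₁ hlead hr₂ hr₃
  -- Dividing the scaling relation by `β` gives `α = Δ / β` and `α' = 1 / β`. The condition on `ρ`
  -- is then the equation of `rμ`, since the node has second coordinate `1`.
  have data : ConicData i p' v' ![r₁, 1, r₃, r₂] c rμ
      (segre p' / algebraMap K (AlgebraicClosure K) β) (1 / algebraMap K (AlgebraicClosure K) β) := by
    refine ⟨hsm, hind, hc, div_ne_zero hd0 hb0, one_div_ne_zero hb0, ⟨_, _, _, ht⟩, ?_, ?_⟩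
    · intro j
      field_simp
      linear_combination hβ' j
    · simp only [muPoly, Polynomial.IsRoot.def, Polynomial.eval_add, Polynomial.eval_pow,
        Polynomial.eval_X, Polynomial.eval_C] at hrμ
      simp only [edge, Matrix.cons_val]
      field_simp at hrμ ⊢
      linear_combination hrμ
  refine ⟨data.ncard_isAssociatedConic, fun Z hZ => ?_⟩
  obtain ⟨a, b, sg, rfl⟩ := data.exists_conic_eq hZ
  have hd := data.translate a b sg
  have mem : ∀ x ∈ ({r₁, r₂, rμ, rμ'} : Set (AlgebraicClosure K)),
      x ∈ IntermediateField.adjoin K {r₁, r₂, rμ, rμ'} :=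
    fun x hx => IntermediateField.subset_adjoin K _ hx
  have m1 := mem r₁ (by simp)
  have m2 := mem r₂ (by simp)
  have mμ := mem rμ (by simp)
  generalize IntermediateField.adjoin K {r₁, r₂, rμ, rμ'} = L at *
  have mv : ∀ j, v' j ∈ L := by
    intro j
    rw [hv']
    exact L.algebraMap_mem _
  -- The equation of `r₃` is linear with nonzero leading coefficient, so `r₃` is rational in `r₁,
  -- r₂`.
  have m3 : r₃ ∈ L := by
    have h0 := data.ne_zero 0
    have h3 := data.ne_zero 3
    simp only [Matrix.cons_val] at h0 h3
    have hne : 2 * (v' 2 ^ 2 - 4 * v' 0 ^ 2) * r₂ * r₁ ≠ 0 := by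
      refine mul_ne_zero (mul_ne_zero (mul_ne_zero two_ne_zero ?_) h3) h0
      intro h
      exact ht.four_sub_ne (by linear_combination -h)
    have e : r₃ = -(v' 1 * v' 2 * r₁ ^ 2 + v' 0 * v' 1 + v' 0 * v' 1 * r₁ ^ 4) /
        (2 * (v' 2 ^ 2 - 4 * v' 0 ^ 2) * r₂ * r₁) := by
      rw [eq_div_iff hne]
      linear_combination hr₃
    rw [e]
    have two : (2 : AlgebraicClosure K) ∈ L := ofNat_mem L 2
    have four : (4 : AlgebraicClosure K) ∈ L := ofNat_mem L 4
    exact div_mem (neg_mem (add_mem (add_mem (mul_mem (mul_mem (mv 1) (mv 2)) (pow_mem m1 2))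
      (mul_mem (mv 0) (mv 1))) (mul_mem (mul_mem (mv 0) (mv 1)) (pow_mem m1 4))))
      (mul_mem (mul_mem (mul_mem two (sub_mem (pow_mem (mv 2) 2)
        (mul_mem four (pow_mem (mv 0) 2)))) m2) m1)
  have htL : translate a b ![r₁, 1, r₃, r₂] = fun j => algebraMap L (AlgebraicClosure K)
      (translate a b (![⟨r₁, m1⟩, 1, ⟨r₃, m3⟩, ⟨r₂, m2⟩] : Fin 4 → L) j) := by
    rw [← translate_map]
    congr 1
    refine funext (forall_fin_four.2 ⟨rfl, ?_, rfl, rfl⟩)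
    simp
  have hρL : cond sg rμ (-rμ) = algebraMap L (AlgebraicClosure K)
      (cond sg (⟨rμ, mμ⟩ : L) (-⟨rμ, mμ⟩)) := by
    cases sg
    · simp only [cond_false, map_neg]
      rfl
    · rfl
  exact ⟨hd.conic_subset, ⟨_, _, (hd.isConicEquations htL hρL).2.2⟩,
    fun hline => hd.isSmoothConicOver htL hρL hline⟩
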